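/- Let $\mathcal H,\mathcal K$ be finite dimensional complex Hilbert spaces, let $\mathcal A\subseteq B(\mathcal H)$ and $\mathcal B\subseteq B(\mathcal K)$ be $C^*$-subalgebras containing the identity operators, and let $\mathcal S\subset\mathcal A$ be a set of density operators (positive operators of trace $1$; ${\rm Tr}$ is the trace of $B(\mathcal H)$, resp. $B(\mathcal K)$). For a linear map $T$ between such algebras, $T^*$ is its adjoint with respect to the Hilbert–Schmidt inner products $\langle a,b\rangle={\rm Tr}\,a^*b$. A linear map $\Phi$ is a unital Schwarz map if $\Phi(I)=I$ and $\Phi(a^*a)\ge\Phi(a)^*\Phi(a)$ for all $a$. A linear map $T:\mathcal A\to\mathcal B$ such that $T^*$ is a unital Schwarz map is called reversible for $\mathcal S$ if there is a linear map $R:\mathcal B\to\mathcal A$ such that $R^*$ is a unital Schwarz map and $R(T(\sigma))=\sigma$ for all $\sigma\in\mathcal S$. Let $\|a\|_1={\rm Tr}\,(a^*a)^{1/2}$. Let $T:\mathcal A\to\mathcal B$ be linear and assume: 1. $\mathcal S$ contains an invertible element $\rho$, and $T(\rho)$ is invertible as well; 2. both $T^*$ and $T_\rho$ are unital Schwarz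 maps, where $T_\rho(b)=T(\rho)^{-1/2}\,T(\rho^{1/2}b\rho^{1/2})\,T(\rho)^{-1/2}$ for $b\in\mathcal A$. Let $\tilde{\mathcal S}=\bigcup_{s\in\mathbb R}\rho^{is}\mathcal S\rho^{-is}$. Then: (i) $T$ is reversible for $\mathcal S$ if and only if $\|\sigma-t\rho\|_1=\|T(\sigma)-tT(\rho)\|_1$ for all $\sigma\in\tilde{\mathcal S}$ and all $t\ge 0$. (ii) If $\rho^{is}\mathcal S\rho^{-is}\subseteq\mathcal S$ for all $s\in\mathbb R$, then $T$ is reversible for $\mathcal S$ if and only if $$\|\sigma-t\rho\|_1=\|T(\sigma)-tT(\rho)\|_1\quad\text{for all }\sigma\in\mathcal S,\ t\ge 0.\qquad(*)$$ (iii) If $\mathcal B$ is abelian, then $T$ is reversible for $\mathcal S$ if and only if $(*)$ holds. Moreover, if $\mathcal B$ is abelian and $T$ is reversible for $\mathcal S$ (equivalently, $(*)$ holds), then all elements of $\mathcal S$ commute with each other. (iv) If all elements of $\mathcal S$ commute with $\rho$, then $T$ is reversible for $\mathcal S$ if and only if $(*)$ holds. -/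

import Mathlib

noncomputable section

namespace QRev

variable {H K : Type*}
  [NormedAddCommGroup H] [InnerProductSpace ℂ H] [CompleteSpace H] [FiniteDimensional ℂ H]
  [NormedAddCommGroup K] [InnerProductSpace ℂ K] [CompleteSpace K] [FiniteDimensional ℂ K]

/-- A star subalgebra of the operators on a finite dimensional Hilbert space is closed, hence is a
C*-algebra and carries the continuous functional calculus. -/
instance isClosed_starSubalgebra (A : StarSubalgebra ℂ (H →L[ℂ] H)) :
    IsClosed (A : Set (H →L[ℂ] H)) :=
  Submodule.closed_of_finiteDimensional (Subalgebra.toSubmodule A.toSubalgebra)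

instance finiteDimensional_starSubalgebra (A : StarSubalgebra ℂ (H →L[ℂ] H)) :
    FiniteDimensional ℂ A :=
  inferInstanceAs (FiniteDimensional ℂ (Subalgebra.toSubmodule A.toSubalgebra))

/-- The trace `Tr_H` on the operators on `H`. -/
def tr : (H →L[ℂ] H) →ₗ[ℂ] ℂ :=
  LinearMap.trace ℂ H ∘ₗ ContinuousLinearMap.coeLM ℂ

/-- The trace norm `‖a‖₁ = Tr |a|`, where `|a| = (a* a)^{1/2}`. -/
def traceNorm (a : H →L[ℂ] H) : ℝ := (tr (CFC.abs a)).re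

/-- Density operators (identified with states) of the algebra `A`. -/
def IsState {A : StarSubalgebra ℂ (H →L[ℂ] H)} (ρ : A) : Prop :=
  0 ≤ (ρ : H →L[ℂ] H) ∧ tr (ρ : H →L[ℂ] H) = 1

/-- The power `ρ ^ z` of a positive element, with a complex exponent `z`. On the kernel of `ρ` the
value is `0` for `z ≠ 0`, so that negative powers are powers of the generalized inverse. -/
def opPow {A : StarSubalgebra ℂ (H →L[ℂ] H)} (ρ : A) (z : ℂ) : A :=
  cfc (fun w : ℂ => w ^ z) ρ

/-- The linear map `x ↦ (a ↦ Tr (x a))` from `A` to its dual. -/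
def trForm (A : StarSubalgebra ℂ (H →L[ℂ] H)) : A →ₗ[ℂ] Module.Dual ℂ A where
  toFun x := tr ∘ₗ A.subtype.toLinearMap ∘ₗ LinearMap.mulLeft ℂ x
  map_add' x y := by ext a; simp [add_mul]
  map_smul' c x := by ext a; simp

@[simp] lemma trForm_apply (A : StarSubalgebra ℂ (H →L[ℂ] H)) (x a : A) :
    trForm A x a = tr ((x * a : A) : H →L[ℂ] H) := rfl

lemma eq_zero_of_tr_star_mul_self (x : H →L[ℂ] H) (h : tr (star x * x) = 0) : x = 0 := by
  have key : tr (star x * x) =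
      ((∑ i, ‖x (stdOrthonormalBasis ℂ H i)‖ ^ 2 : ℝ) : ℂ) := by
    change LinearMap.trace ℂ H _ = _
    rw [LinearMap.trace_eq_sum_inner _ (stdOrthonormalBasis ℂ H)]
    push_cast
    refine Finset.sum_congr rfl fun i _ => ?_
    change inner ℂ _ ((ContinuousLinearMap.adjoint x) (x _)) = _
    rw [ContinuousLinearMap.adjoint_inner_right, inner_self_eq_norm_sq_to_K]
    rfl
  rw [key] at h
  have h' : ∑ i, ‖x (stdOrthonormalBasis ℂ H i)‖ ^ 2 = 0 := by exact_mod_cast h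
  rw [Finset.sum_eq_zero_iff_of_nonneg (fun i _ => by positivity)] at h'
  apply ContinuousLinearMap.coe_injective
  refine (stdOrthonormalBasis ℂ H).toBasis.ext fun i => ?_
  have := h' i (Finset.mem_univ i)
  simpa using this

lemma trForm_injective (A : StarSubalgebra ℂ (H →L[ℂ] H)) :
    Function.Injective (trForm A) := by
  rw [injective_iff_map_eq_zero]
  intro x hx
  have h : tr (((x * star x : A)) : H →L[ℂ] H) = 0 := by
    rw [← trForm_apply, hx]; rfl
  have := eq_zero_of_tr_star_mul_self (star (x : H →L[ℂ] H)) (by simpa using h)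
  exact Subtype.ext (by simpa using this)

/-- The identification of `A` with its dual through the trace. -/
def trEquiv (A : StarSubalgebra ℂ (H →L[ℂ] H)) : A ≃ₗ[ℂ] Module.Dual ℂ A :=
  (trForm A).linearEquivOfInjective (trForm_injective A) Subspace.dual_finrank_eq.symm

/-- The adjoint `T*` of `T` with respect to the Hilbert-Schmidt inner products
`⟨a, b⟩ = Tr (a* b)` (see `hsAdjoint_spec`). -/
def hsAdjoint {A : StarSubalgebra ℂ (H →L[ℂ] H)} {B : StarSubalgebra ℂ (K →L[ℂ] K)}
    (T : A →ₗ[ℂ] B) : B →ₗ[ℂ] A where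
  toFun b := star ((trEquiv A).symm (trForm B (star b) ∘ₗ T))
  map_add' x y := by simp [LinearMap.add_comp]
  map_smul' c x := by simp [LinearMap.smul_comp]

theorem hsAdjoint_spec {A : StarSubalgebra ℂ (H →L[ℂ] H)} {B : StarSubalgebra ℂ (K →L[ℂ] K)}
    (T : A →ₗ[ℂ] B) (a : A) (b : B) :
    tr ((star (hsAdjoint T b) * a : A) : H →L[ℂ] H) = tr ((star b * T a : B) : K →L[ℂ] K) := by
  have h : trForm A (star (hsAdjoint T b)) = trForm B (star b) ∘ₗ T := by
    change trForm A (star (star ((trEquiv A).symm (trForm B (star b) ∘ₗ T)))) = _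
    rw [star_star]
    exact (trEquiv A).apply_symm_apply (trForm B (star b) ∘ₗ T)
  exact LinearMap.congr_fun h a

/-- Unital Schwarz maps: linear maps with `Φ(I) = I` and `Φ(a)* Φ(a) ≤ Φ(a* a)`. -/
def IsUnitalSchwarz {A : StarSubalgebra ℂ (H →L[ℂ] H)} {B : StarSubalgebra ℂ (K →L[ℂ] K)}
    (Φ : A →ₗ[ℂ] B) : Prop :=
  Φ 1 = 1 ∧ ∀ a : A,
    ((star (Φ a) * Φ a : B) : K →L[ℂ] K) ≤ ((Φ (star a * a) : B) : K →L[ℂ] K)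

/-- The map `T_ρ(b) = T(ρ)^{-1/2} T(ρ^{1/2} b ρ^{1/2}) T(ρ)^{-1/2}`. -/
def dualMap {A : StarSubalgebra ℂ (H →L[ℂ] H)} {B : StarSubalgebra ℂ (K →L[ℂ] K)}
    (T : A →ₗ[ℂ] B) (ρ : A) : A →ₗ[ℂ] B where
  toFun b := opPow (T ρ) (-(1 / 2)) * T (opPow ρ (1 / 2) * b * opPow ρ (1 / 2)) *
    opPow (T ρ) (-(1 / 2))
  map_add' x y := by simp [mul_add, add_mul]
  map_smul' c x := by simp

/-- `T` is reversible for `S`: there is a linear map `R : B → A` such that `R*` is a unital Schwarz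
map and `R (T σ) = σ` for all `σ` in `S`. -/
def IsReversible {A : StarSubalgebra ℂ (H →L[ℂ] H)} {B : StarSubalgebra ℂ (K →L[ℂ] K)}
    (T : A →ₗ[ℂ] B) (S : Set A) : Prop :=
  ∃ R : B →ₗ[ℂ] A, IsUnitalSchwarz (hsAdjoint R) ∧ ∀ σ ∈ S, R (T σ) = σ

/-- `ρ^{is} σ ρ^{-is}`. -/
def modConj {A : StarSubalgebra ℂ (H →L[ℂ] H)} (ρ : A) (s : ℝ) (σ : A) : A :=
  opPow ρ (Complex.I * s) * σ * opPow ρ (-(Complex.I * s))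

/-- The extended family `⋃ₛ ρ^{is} S ρ^{-is}`. -/
def extFamily {A : StarSubalgebra ℂ (H →L[ℂ] H)} (ρ : A) (S : Set A) : Set A :=
  ⋃ s : ℝ, modConj ρ s '' S

/-- `‖σ - tρ‖₁ = ‖T(σ) - tT(ρ)‖₁` for all `σ` in `S` and all `t ≥ 0`. -/
def PreservesTraceNorm {A : StarSubalgebra ℂ (H →L[ℂ] H)} {B : StarSubalgebra ℂ (K →L[ℂ] K)}
    (T : A →ₗ[ℂ] B) (ρ : A) (S : Set A) : Prop :=
  ∀ σ ∈ S, ∀ t : ℝ, 0 ≤ t →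
    traceNorm ((σ - (t : ℂ) • ρ : A) : H →L[ℂ] H) =
      traceNorm ((T σ - (t : ℂ) • T ρ : B) : K →L[ℂ] K)

end QRev

end

/-!
Let `Φ = T*` and call `X_t = σ - t ρ` for `σ` in the extended family the pencil of `σ`.

If `R` reverses `T` on `S`, then the unital Schwarz map `Φ ∘ R*` has an adjoint fixing the
invertible `ρ`. Its fixed points lie in its multiplicative domain, and `f ↦ f ρ` maps them onto the
fixed points of `R ∘ T`, which are therefore invariant under the modular group of `ρ`. As `T` and
`R` contract the trace norm, `T` preserves it on the pencils.

Conversely, the second difference `‖X_t + e ρ‖₁ + ‖X_t - e ρ‖₁ - 2 ‖X_t‖₁` is asymptotic to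
`2 e Tr (ρ k)`, where `k` is the projection onto the kernel of `X_t`. If the trace norms agree, this
forces `Φ` to map the kernel projection of `T X_t` to `k`, so `k` is the image of an element of the
multiplicative domain of `Φ`. Modular invariance then gives `Φ (T_ρ k) = k`, and the map `R = T_ρ*`
satisfies `R (T X_t) k = R (T (X_t k)) = 0`, that is, `R (T σ) k = t ρ k = σ k`. The projections `k`
for varying `t` determine an operator, so `R (T σ) = σ`. If `B` is abelian they commute, which makes
`σ` commute with `ρ`.
-/

namespace Tracial

open scoped ComplexOrder Pointwise
open Filter Topology
open Polynomial (aeval)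

section FunctionalCalculus

variable {A : Type*} [CStarAlgebra A]

/-- The spectral projection of a selfadjoint element for the point `r`. It is `0` unless `r` is an
eigenvalue; `specProj a 0` is the projection onto the kernel of `a`. -/
noncomputable def specProj (a : A) (r : ℝ) : A := cfc (fun x : ℝ => if x = r then 1 else 0) a

/-- The sign of a selfadjoint element, which vanishes on its kernel. -/
noncomputable def sgn (a : A) : A := cfc (fun x : ℝ => (SignType.sign x : ℝ)) a

variable [FiniteDimensional ℂ A]

lemma finite_spectrum_complex (a : A) : (spectrum ℂ a).Finite := by
  cases subsingleton_or_nontrivial A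
  · rw [spectrum.of_subsingleton]
    exact Set.finite_empty
  have hp : minpoly ℂ a ≠ 0 := minpoly.ne_zero (Algebra.IsIntegral.isIntegral a)
  refine (minpoly ℂ a).roots.toFinset.finite_toSet.subset fun z hz => ?_
  have h := spectrum.subset_polynomial_aeval a (minpoly ℂ a) ⟨z, hz, rfl⟩
  have hroot : (minpoly ℂ a).eval z = 0 := by simpa using h
  simpa [hp] using hroot

lemma finite_spectrum_real (a : A) : (spectrum ℝ a).Finite := by
  rw [← spectrum.preimage_algebraMap ℂ]
  exact (finite_spectrum_complex a).preimage Complex.ofReal_injective.injOn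

lemma continuousOn_spectrum_complex (f : ℂ → ℂ) (a : A) : ContinuousOn f (spectrum ℂ a) :=
  (finite_spectrum_complex a).continuousOn f

lemma continuousOn_spectrum_real (f : ℝ → ℝ) (a : A) : ContinuousOn f (spectrum ℝ a) :=
  (finite_spectrum_real a).continuousOn f

lemma isStarProjection_specProj (a : A) (r : ℝ) : IsStarProjection (specProj a r) where
  isSelfAdjoint := cfc_predicate _ a
  isIdempotentElem := by
    rw [IsIdempotentElem, specProj, ← cfc_mul _ _ a (continuousOn_spectrum_real _ a)
      (continuousOn_spectrum_real _ a)]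
    exact cfc_congr fun x _ => by simp

lemma cfc_mul_specProj (f : ℝ → ℝ) (a : A) (r : ℝ) :
    cfc f a * specProj a r = f r • specProj a r := by
  rw [specProj, ← cfc_mul _ _ a (continuousOn_spectrum_real _ a) (continuousOn_spectrum_real _ a),
    ← cfc_smul _ _ a (continuousOn_spectrum_real _ a)]
  exact cfc_congr fun x _ => by by_cases hx : x = r <;> simp [hx]

lemma mul_specProj {a : A} (ha : IsSelfAdjoint a) (r : ℝ) :
    a * specProj a r = r • specProj a r := by
  simpa only [cfc_id' ℝ a] using cfc_mul_specProj (fun x => x) a r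

lemma mul_specProj_zero {a : A} (ha : IsSelfAdjoint a) : a * specProj a 0 = 0 := by
  rw [mul_specProj ha, zero_smul]

lemma specProj_zero_mul_of_mul_eq_zero {a c : A} (ha : IsSelfAdjoint a) (h : a * c = 0) :
    specProj a 0 * c = c := by
  have hcompl : specProj a 0 = 1 - cfc (fun x : ℝ => x⁻¹) a * a := by
    conv_rhs => rw [← cfc_one ℝ a]; right; right; rw [← cfc_id' ℝ a]
    rw [← cfc_mul _ _ a (continuousOn_spectrum_real _ a) (continuousOn_spectrum_real _ a),
      ← cfc_sub _ _ a (continuousOn_spectrum_real _ a) (continuousOn_spectrum_real _ a)]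
    exact cfc_congr fun x _ => by by_cases hx : x = 0 <;> simp [hx]
  rw [hcompl, sub_mul, mul_assoc, h, mul_zero, sub_zero, one_mul]

lemma sum_specProj {a : A} (ha : IsSelfAdjoint a) :
    ∑ r ∈ (finite_spectrum_real a).toFinset, specProj a r = 1 := by
  simp only [specProj]
  rw [← cfc_sum _ _ _ fun _ _ => continuousOn_spectrum_real _ a, ← cfc_one ℝ a]
  exact cfc_congr fun x hx => by simpa using hx

variable [PartialOrder A] [StarOrderedRing A]

lemma mul_sgn {a : A} (ha : IsSelfAdjoint a) : a * sgn a = CFC.abs a := by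
  conv_lhs => left; rw [← cfc_id' ℝ a]
  rw [sgn, ← cfc_mul _ _ a (continuousOn_spectrum_real _ a) (continuousOn_spectrum_real _ a),
    CFC.abs_eq_cfc_norm a ha]
  exact cfc_congr fun x _ => by simp

lemma mul_sgn_add_smul_specProj {a : A} (ha : IsSelfAdjoint a) (c : ℝ) :
    a * (sgn a + c • specProj a 0) = CFC.abs a := by
  rw [mul_add, mul_sgn ha, mul_smul_comm, mul_specProj_zero ha, smul_zero, add_zero]

lemma sgn_add_smul_specProj_mem_Icc {a : A} (ha : IsSelfAdjoint a) {c : ℝ} (hc : |c| ≤ 1) :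
    sgn a + c • specProj a 0 ∈ Set.Icc (-1) 1 := by
  have hcfc : sgn a + c • specProj a 0 =
      cfc (fun x : ℝ => SignType.sign x + c * if x = 0 then 1 else 0) a := by
    rw [cfc_add (hf := continuousOn_spectrum_real _ a) (hg := continuousOn_spectrum_real _ a),
      cfc_const_mul c (fun x : ℝ => if x = 0 then 1 else 0) a (continuousOn_spectrum_real _ a)]
    rfl
  obtain ⟨hc₁, hc₂⟩ := abs_le.1 hc
  rw [hcfc, ← cfc_one ℝ a, ← cfc_neg]
  constructor <;> refine cfc_mono (fun x _ => ?_) (continuousOn_spectrum_real _ a)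
    (continuousOn_spectrum_real _ a) <;>
  rcases lt_trichotomy x 0 with h | h | h <;> simp [h, ne_of_lt, ne_of_gt, hc₁, hc₂]

lemma sgn_mem_Icc {a : A} (ha : IsSelfAdjoint a) : sgn a ∈ Set.Icc (-1) 1 := by
  simpa only [zero_smul, add_zero] using
    sgn_add_smul_specProj_mem_Icc ha (c := 0) (by simp)

end FunctionalCalculus

section SchwarzMaps

variable {A B C : Type*} [CStarAlgebra A] [CStarAlgebra B] [CStarAlgebra C]
  [PartialOrder B] [StarOrderedRing B] [PartialOrder C] [StarOrderedRing C]

/-- The multiplicative domain of a linear map: the elements on products with which the map is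
multiplicative. -/
def multDomain (Φ : A →ₗ[ℂ] B) : Submodule ℂ A where
  carrier := {m | ∀ x, Φ (x * m) = Φ x * Φ m ∧ Φ (m * x) = Φ m * Φ x}
  add_mem' ha hb x := by simp [mul_add, add_mul, ha x, hb x]
  zero_mem' x := by simp
  smul_mem' c a ha x := by simp [ha x]

/-- Unital Schwarz maps between C⋆-algebras. -/
structure IsUnitalSchwarz (Φ : A →ₗ[ℂ] B) : Prop where
  map_one : Φ 1 = 1
  star_mul_le : ∀ a, star (Φ a) * Φ a ≤ Φ (star a * a)

lemma eq_zero_of_forall_nonneg_add_smul {a b : B} (h : ∀ t : ℝ, 0 ≤ a + t • b) : b = 0 := by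
  have hpos : ∀ c : B, (∀ t : ℝ, 0 ≤ a + t • c) → 0 ≤ c := fun c hc => by
    have hlim : Tendsto (fun t : ℝ => t⁻¹ • a + c) atTop (𝓝 c) := by
      simpa using ((tendsto_inv_atTop_zero (𝕜 := ℝ)).smul_const a).add_const c
    refine ge_of_tendsto hlim ((eventually_gt_atTop 0).mono fun t ht => ?_)
    simpa [smul_smul, ht.ne'] using smul_nonneg (inv_nonneg.2 ht.le) (hc t)
  refine le_antisymm (neg_nonneg.1 (hpos (-b) fun t => ?_)) (hpos b h)
  simpa using h (-t)

namespace IsUnitalSchwarz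

variable {Φ : A →ₗ[ℂ] B}

variable [PartialOrder A] [StarOrderedRing A]

lemma map_nonneg (hΦ : IsUnitalSchwarz Φ) {a : A} (ha : 0 ≤ a) : 0 ≤ Φ a := by
  obtain ⟨c, rfl⟩ := CStarAlgebra.nonneg_iff_eq_star_mul_self.1 ha
  exact (star_mul_self_nonneg _).trans (hΦ.star_mul_le c)

lemma map_star (hΦ : IsUnitalSchwarz Φ) (a : A) : Φ (star a) = star (Φ a) :=
  _root_.StarHomClass.map_star (PositiveLinearMap.mk₀ Φ fun _ => hΦ.map_nonneg) a

lemma mono (hΦ : IsUnitalSchwarz Φ) {a b : A} (h : a ≤ b) : Φ a ≤ Φ b := by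
  simpa only [map_sub, sub_nonneg] using hΦ.map_nonneg (sub_nonneg.2 h)

lemma map_mem_Icc (hΦ : IsUnitalSchwarz Φ) {a : A} (ha : a ∈ Set.Icc (-1) 1) :
    Φ a ∈ Set.Icc (-1) 1 := by
  simpa only [Set.mem_Icc, map_neg, hΦ.map_one] using And.intro (hΦ.mono ha.1) (hΦ.mono ha.2)

/-- The defect `D(x, y) = Φ (x* y) - Φ(x)* Φ(y)` is a positive sesquilinear form, so `D(a, a) = 0`
forces `D(y, a) = 0`. -/
lemma map_star_mul (hΦ : IsUnitalSchwarz Φ) {a : A} (ha : Φ (star a * a) = star (Φ a) * Φ a)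
    (y : A) : Φ (star y * a) = star (Φ y) * Φ a := by
  set d := Φ (star y * a) - star (Φ y) * Φ a with hd
  have hstar : star d = Φ (star a * y) - star (Φ a) * Φ y := by
    simp [hd, ← hΦ.map_star]
  have hdefect (l : ℂ) :
      0 ≤ (Φ (star y * y) - star (Φ y) * Φ y) + (l • d + star l • star d) := by
    convert sub_nonneg.2 (hΦ.star_mul_le (y + l • a)) using 1
    rw [hstar, hd]
    simp only [map_add, map_smul, star_add, star_smul, mul_add, add_mul, smul_mul_assoc,
      mul_smul_comm, ha, smul_sub, smul_add]
    abel
  have hre : d + star d = 0 := eq_zero_of_forall_nonneg_add_smul fun t => by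
    simpa using hdefect t
  have him : Complex.I • (d - star d) = 0 := eq_zero_of_forall_nonneg_add_smul fun t => by
    have := hdefect (t * Complex.I)
    simp only [star_mul', RCLike.star_def, Complex.conj_ofReal, Complex.conj_I] at this
    convert this using 2
    rw [← Complex.coe_smul t]
    module
  have hsub : d - star d = 0 := (smul_eq_zero.1 him).resolve_left Complex.I_ne_zero
  have h2 : (2 : ℂ) • d = 0 := by
    calc (2 : ℂ) • d = (d + star d) + (d - star d) := by module
      _ = 0 := by rw [hre, hsub, add_zero]
  exact sub_eq_zero.1 ((smul_eq_zero.1 h2).resolve_left two_ne_zero)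

lemma mem_multDomain (hΦ : IsUnitalSchwarz Φ) {a : A}
    (h₁ : Φ (star a * a) = star (Φ a) * Φ a) (h₂ : Φ (a * star a) = Φ a * star (Φ a)) :
    a ∈ multDomain Φ := fun x => by
  constructor
  · simpa only [hΦ.map_star, star_star] using hΦ.map_star_mul h₁ (star x)
  · have h := hΦ.map_star_mul (a := star a) (by simpa only [hΦ.map_star, star_star] using h₂) x
    simpa only [← hΦ.map_star, star_mul, star_star] using congrArg star h

lemma mem_multDomain_of_isStarProjection (hΦ : IsUnitalSchwarz Φ) {p : A}
    (hp : IsStarProjection p) (hΦp : IsStarProjection (Φ p)) : p ∈ multDomain Φ := by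
  apply hΦ.mem_multDomain <;>
  simp only [hp.isSelfAdjoint.star_eq, hΦp.isSelfAdjoint.star_eq, hp.isIdempotentElem.eq,
    hΦp.isIdempotentElem.eq]

omit [PartialOrder A] [StarOrderedRing A] in
lemma comp {Θ : B →ₗ[ℂ] C} (hΘ : IsUnitalSchwarz Θ) (hΦ : IsUnitalSchwarz Φ) :
    IsUnitalSchwarz (Θ ∘ₗ Φ) where
  map_one := by simp only [LinearMap.comp_apply, hΦ.map_one, hΘ.map_one]
  star_mul_le a := (hΘ.star_mul_le (Φ a)).trans (hΘ.mono (hΦ.star_mul_le a))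

end IsUnitalSchwarz

end SchwarzMaps

section Trace

variable {A B C : Type*} [CStarAlgebra A] [CStarAlgebra B] [CStarAlgebra C]

/-- Faithful tracial positive functionals, the abstract counterpart of the trace of `B(H)`
restricted to a subalgebra. -/
structure IsFaithfulTrace (φ : A →ₗ[ℂ] ℂ) : Prop where
  map_mul_comm : ∀ a b, φ (a * b) = φ (b * a)
  map_star_mul_self_nonneg : ∀ a, 0 ≤ φ (star a * a)
  eq_zero_of_map_star_mul_self : ∀ a, φ (star a * a) = 0 → a = 0

/-- `Φ` is the adjoint of `T` for the bilinear trace forms `(a, b) ↦ φ (a b)`. For star preserving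
`Φ` this is the adjoint for the Hilbert-Schmidt inner products `⟨a, b⟩ = φ (a* b)`. -/
def IsTraceAdjoint (φ : A →ₗ[ℂ] ℂ) (ψ : B →ₗ[ℂ] ℂ) (T : A →ₗ[ℂ] B) (Φ : B →ₗ[ℂ] A) : Prop :=
  ∀ a b, ψ (T a * b) = φ (a * Φ b)

namespace IsFaithfulTrace

variable {φ : A →ₗ[ℂ] ℂ}

lemma map_mul_cycle (hφ : IsFaithfulTrace φ) (a b c : A) : φ (a * b * c) = φ (c * a * b) := by
  rw [hφ.map_mul_comm, mul_assoc]

lemma ext (hφ : IsFaithfulTrace φ) {a b : A} (h : ∀ x, φ (a * x) = φ (b * x)) : a = b := by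
  have h0 := hφ.eq_zero_of_map_star_mul_self (a - b) (by
    rw [hφ.map_mul_comm, sub_mul, map_sub, h, sub_self])
  exact sub_eq_zero.1 h0

end IsFaithfulTrace

section

variable {φ : A →ₗ[ℂ] ℂ} {ψ : B →ₗ[ℂ] ℂ} {T : A →ₗ[ℂ] B} {Φ : B →ₗ[ℂ] A}

lemma IsTraceAdjoint.comp {χ : C →ₗ[ℂ] ℂ} {R : B →ₗ[ℂ] C} {Θ : C →ₗ[ℂ] B}
    (hR : IsTraceAdjoint ψ χ R Θ) (hT : IsTraceAdjoint φ ψ T Φ) :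
    IsTraceAdjoint φ χ (R ∘ₗ T) (Φ ∘ₗ Θ) := fun a c =>
  (hR (T a) c).trans (hT a (Θ c))

lemma IsTraceAdjoint.map_mul_map_of_mem_multDomain (hT : IsTraceAdjoint φ ψ T Φ)
    (hψ : IsFaithfulTrace ψ) {m : B} (hm : m ∈ multDomain Φ) (a : A) : T (a * Φ m) = T a * m :=
  hψ.ext fun b => by rw [hT, mul_assoc, ← (hm b).2, ← hT, mul_assoc]

lemma IsTraceAdjoint.map_map_mul_of_mem_multDomain (hT : IsTraceAdjoint φ ψ T Φ)
    (hφ : IsFaithfulTrace φ) (hψ : IsFaithfulTrace ψ) {m : B} (hm : m ∈ multDomain Φ) (a : A) :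
    T (Φ m * a) = m * T a :=
  hψ.ext fun b => by
    rw [hT, hφ.map_mul_cycle, ← (hm b).1, hφ.map_mul_comm, ← hT, ← mul_assoc, hψ.map_mul_cycle,
      mul_assoc, hψ.map_mul_comm]

lemma IsTraceAdjoint.map_trace [PartialOrder A] (hT : IsTraceAdjoint φ ψ T Φ)
    (hΦ : IsUnitalSchwarz Φ) (a : A) : ψ (T a) = φ a := by
  simpa only [mul_one, hΦ.map_one] using hT a 1

end

namespace IsFaithfulTrace

variable {φ : A →ₗ[ℂ] ℂ} [PartialOrder A] [StarOrderedRing A]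

lemma map_nonneg (hφ : IsFaithfulTrace φ) {a : A} (ha : 0 ≤ a) : 0 ≤ φ a := by
  obtain ⟨c, rfl⟩ := CStarAlgebra.nonneg_iff_eq_star_mul_self.1 ha
  exact hφ.map_star_mul_self_nonneg c

lemma map_star (hφ : IsFaithfulTrace φ) (a : A) : φ (star a) = star (φ a) :=
  StarHomClass.map_star (PositiveLinearMap.mk₀ φ fun _ => hφ.map_nonneg) a

lemma exists_map_mul_eq (hφ : IsFaithfulTrace φ) {a b : A} (ha : 0 ≤ a) (hb : 0 ≤ b) :
    ∃ c, φ (a * b) = φ (star c * c) ∧ (c = 0 → a * b = 0) := by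
  obtain ⟨x, rfl⟩ := CStarAlgebra.nonneg_iff_eq_star_mul_self.1 ha
  obtain ⟨y, rfl⟩ := CStarAlgebra.nonneg_iff_eq_star_mul_self.1 hb
  refine ⟨x * star y, ?_, fun h => ?_⟩
  · rw [← mul_assoc, hφ.map_mul_comm]
    simp only [star_mul, star_star, mul_assoc]
  · calc star x * x * (star y * y) = star x * (x * star y) * y := by simp only [mul_assoc]
      _ = 0 := by rw [h, mul_zero, zero_mul]

lemma map_mul_nonneg (hφ : IsFaithfulTrace φ) {a b : A} (ha : 0 ≤ a) (hb : 0 ≤ b) :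
    0 ≤ φ (a * b) := by
  obtain ⟨c, hc, -⟩ := hφ.exists_map_mul_eq ha hb
  exact hc ▸ hφ.map_star_mul_self_nonneg c

lemma mul_eq_zero_of_map_mul (hφ : IsFaithfulTrace φ) {a b : A} (ha : 0 ≤ a) (hb : 0 ≤ b)
    (h : φ (a * b) = 0) : a * b = 0 := by
  obtain ⟨c, hc, hab⟩ := hφ.exists_map_mul_eq ha hb
  exact hab (hφ.eq_zero_of_map_star_mul_self c (hc ▸ h))

lemma eq_zero_of_map_mul_of_isUnit (hφ : IsFaithfulTrace φ) {a b : A} (ha : 0 ≤ a) (hb : 0 ≤ b)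
    (hu : IsUnit a) (h : φ (a * b) = 0) : b = 0 :=
  hu.mul_right_eq_zero.1 (hφ.mul_eq_zero_of_map_mul ha hb h)

lemma nonneg_of_forall_map_mul_nonneg (hφ : IsFaithfulTrace φ) {a : A} (ha : IsSelfAdjoint a)
    (h : ∀ b, 0 ≤ b → 0 ≤ φ (a * b)) : 0 ≤ a := by
  have hneg : a * a⁻ = -(star a⁻ * a⁻) := by
    rw [(IsSelfAdjoint.of_nonneg (CFC.negPart_nonneg a)).star_eq]
    nth_rewrite 1 [← CFC.posPart_sub_negPart a ha]
    rw [sub_mul, CFC.posPart_mul_negPart, zero_sub]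
  have hle := h a⁻ (CFC.negPart_nonneg a)
  rw [hneg, map_neg, neg_nonneg] at hle
  have hzero := hφ.eq_zero_of_map_star_mul_self _
    (le_antisymm hle (hφ.map_star_mul_self_nonneg a⁻))
  exact (CFC.negPart_eq_zero_iff a ha).1 hzero

end IsFaithfulTrace

section Adjoint

variable [PartialOrder A] [StarOrderedRing A] [PartialOrder B] [StarOrderedRing B]
  {φ : A →ₗ[ℂ] ℂ} {ψ : B →ₗ[ℂ] ℂ} {T : A →ₗ[ℂ] B} {Φ : B →ₗ[ℂ] A}

namespace IsTraceAdjoint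

lemma map_star (hT : IsTraceAdjoint φ ψ T Φ) (hΦ : IsUnitalSchwarz Φ) (hφ : IsFaithfulTrace φ)
    (hψ : IsFaithfulTrace ψ) (a : A) : T (star a) = star (T a) := by
  refine hψ.ext fun b => ?_
  calc ψ (T (star a) * b) = φ (star a * Φ b) := hT _ _
    _ = star (φ (a * Φ (star b))) := by
      rw [hΦ.map_star, ← hφ.map_star, star_mul, star_star, hφ.map_mul_comm]
    _ = ψ (star (T a) * b) := by
      rw [← hT, ← hψ.map_star, star_mul, star_star, hψ.map_mul_comm]

lemma isSelfAdjoint_map (hT : IsTraceAdjoint φ ψ T Φ) (hΦ : IsUnitalSchwarz Φ)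
    (hφ : IsFaithfulTrace φ) (hψ : IsFaithfulTrace ψ) {a : A} (ha : IsSelfAdjoint a) :
    IsSelfAdjoint (T a) := by
  rw [IsSelfAdjoint, ← hT.map_star hΦ hφ hψ, ha.star_eq]

lemma map_nonneg (hT : IsTraceAdjoint φ ψ T Φ) (hΦ : IsUnitalSchwarz Φ) (hφ : IsFaithfulTrace φ)
    (hψ : IsFaithfulTrace ψ) {a : A} (ha : 0 ≤ a) : 0 ≤ T a :=
  hψ.nonneg_of_forall_map_mul_nonneg
    (hT.isSelfAdjoint_map hΦ hφ hψ (IsSelfAdjoint.of_nonneg ha)) fun b hb => by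
      rw [hT]
      exact hφ.map_mul_nonneg ha (hΦ.map_nonneg hb)

end IsTraceAdjoint

end Adjoint

end Trace

section TraceNorm

variable {A B : Type*} [CStarAlgebra A] [PartialOrder A] [StarOrderedRing A]
  [CStarAlgebra B] [PartialOrder B] [StarOrderedRing B]
  {φ : A →ₗ[ℂ] ℂ} {ψ : B →ₗ[ℂ] ℂ} {T : A →ₗ[ℂ] B} {Φ : B →ₗ[ℂ] A}

/-- The trace norm `φ |a|`; its values are real when `φ` is positive. -/
noncomputable def traceNorm (φ : A →ₗ[ℂ] ℂ) (a : A) : ℝ := (φ (CFC.abs a)).re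

lemma traceNorm_of_nonneg (φ : A →ₗ[ℂ] ℂ) {a : A} (ha : 0 ≤ a) : traceNorm φ a = (φ a).re := by
  rw [traceNorm, CFC.abs_of_nonneg a ha]

lemma mul_eq_abs_sub {X : A} (hX : IsSelfAdjoint X) (u : A) :
    X * u = CFC.abs X - (X⁺ * (1 - u) + X⁻ * (1 + u)) := by
  rw [← CFC.posPart_add_negPart X hX]
  nth_rewrite 1 [← CFC.posPart_sub_negPart X hX]
  noncomm_ring

lemma IsFaithfulTrace.re_map_mul_le_traceNorm (hφ : IsFaithfulTrace φ) {X u : A}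
    (hX : IsSelfAdjoint X) (hu : u ∈ Set.Icc (-1) 1) : (φ (X * u)).re ≤ traceNorm φ X := by
  have hpos := hφ.map_mul_nonneg (CFC.posPart_nonneg X) (sub_nonneg.2 hu.2)
  have hneg := hφ.map_mul_nonneg (CFC.negPart_nonneg X) (neg_le_iff_add_nonneg'.1 hu.1)
  have := (Complex.le_def.1 (add_nonneg hpos hneg)).1
  rw [mul_eq_abs_sub hX, traceNorm, map_sub, map_add, Complex.sub_re]
  simpa using this

lemma IsFaithfulTrace.mul_eq_abs_of_re_map_mul_eq (hφ : IsFaithfulTrace φ) {X u : A}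
    (hX : IsSelfAdjoint X) (hu : u ∈ Set.Icc (-1) 1) (h : (φ (X * u)).re = traceNorm φ X) :
    X * u = CFC.abs X := by
  have hu₁ := sub_nonneg.2 hu.2
  have hu₂ := neg_le_iff_add_nonneg'.1 hu.1
  have hpos := hφ.map_mul_nonneg (CFC.posPart_nonneg X) hu₁
  have hneg := hφ.map_mul_nonneg (CFC.negPart_nonneg X) hu₂
  have hsum : φ (X⁺ * (1 - u)) + φ (X⁻ * (1 + u)) = 0 := by
    refine le_antisymm ?_ (add_nonneg hpos hneg)
    rw [mul_eq_abs_sub hX, traceNorm, map_sub, map_add, Complex.sub_re, sub_eq_self] at h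
    exact Complex.le_def.2 ⟨h.le, (Complex.le_def.1 (add_nonneg hpos hneg)).2.symm⟩
  obtain ⟨hpos0, hneg0⟩ := (add_eq_zero_iff_of_nonneg hpos hneg).1 hsum
  rw [mul_eq_abs_sub hX, hφ.mul_eq_zero_of_map_mul (CFC.posPart_nonneg X) hu₁ hpos0,
    hφ.mul_eq_zero_of_map_mul (CFC.negPart_nonneg X) hu₂ hneg0, add_zero, sub_zero]

lemma re_map_mul_sgn_add_smul_specProj [FiniteDimensional ℂ A] (φ : A →ₗ[ℂ] ℂ) {X : A}
    (hX : IsSelfAdjoint X) (c : ℝ) :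
    (φ (X * (sgn X + c • specProj X 0))).re = traceNorm φ X := by
  rw [mul_sgn_add_smul_specProj hX, traceNorm]

lemma IsTraceAdjoint.traceNorm_map_le [FiniteDimensional ℂ B] (hT : IsTraceAdjoint φ ψ T Φ)
    (hΦ : IsUnitalSchwarz Φ) (hφ : IsFaithfulTrace φ) (hψ : IsFaithfulTrace ψ) {X : A}
    (hX : IsSelfAdjoint X) : traceNorm ψ (T X) ≤ traceNorm φ X := by
  have hTX := hT.isSelfAdjoint_map hΦ hφ hψ hX
  calc traceNorm ψ (T X) = (φ (X * Φ (sgn (T X)))).re := by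
        rw [← hT, mul_sgn hTX, traceNorm]
    _ ≤ traceNorm φ X := hφ.re_map_mul_le_traceNorm hX (hΦ.map_mem_Icc (sgn_mem_Icc hTX))

end TraceNorm

section Pencil

variable {A B : Type*} [CStarAlgebra A] [PartialOrder A] [StarOrderedRing A]
  [FiniteDimensional ℂ A] [CStarAlgebra B] [PartialOrder B] [StarOrderedRing B]
  [FiniteDimensional ℂ B]
  {φ : A →ₗ[ℂ] ℂ} {ψ : B →ₗ[ℂ] ℂ} {T : A →ₗ[ℂ] B} {Φ : B →ₗ[ℂ] A} {X Y : A}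

lemma le_smul_specProj_zero {d : A} (hX : IsSelfAdjoint X) (hd : IsSelfAdjoint d) {r : ℝ}
    (hdr : d ≤ r • 1) (h : X * d = 0) : d ≤ r • specProj X 0 := by
  have hp := isStarProjection_specProj X 0
  have hpd := specProj_zero_mul_of_mul_eq_zero hX h
  have hdp : d * specProj X 0 = d := by
    simpa [hd.star_eq, hp.isSelfAdjoint.star_eq] using congrArg star hpd
  simpa [hp.isSelfAdjoint.star_eq, hpd, hdp, hp.isIdempotentElem.eq] using
    star_left_conjugate_le_conjugate hdr (specProj X 0)

lemma isCompact_Icc_neg_one_one : IsCompact (Set.Icc (-1 : A) 1) := by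
  refine Metric.isCompact_of_isClosed_isBounded isClosed_Icc ?_
  refine (Metric.isBounded_iff_subset_closedBall (-1)).2 ⟨‖(1 + 1 : A)‖, fun v hv => ?_⟩
  rw [mem_closedBall_iff_norm]
  refine CStarAlgebra.norm_le_norm_of_nonneg_of_le (sub_nonneg.2 hv.1) ?_
  rw [sub_neg_eq_add]
  exact add_le_add hv.2 le_rfl

lemma traceNorm_add_smul_add_traceNorm_sub_smul (φ : A →ₗ[ℂ] ℂ) (hX : IsSelfAdjoint X)
    (hY : IsSelfAdjoint Y) (e : ℝ) :
    traceNorm φ (X + e • Y) + traceNorm φ (X - e • Y) =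
      (φ (X * sgn (X + e • Y))).re + (φ (X * sgn (X - e • Y))).re +
        e * (φ (Y * (sgn (X + e • Y) - sgn (X - e • Y)))).re := by
  have heY : IsSelfAdjoint (e • Y) := (IsSelfAdjoint.all e).smul hY
  rw [traceNorm, traceNorm, ← mul_sgn (hX.add heY), ← mul_sgn (hX.sub heY)]
  simp only [add_mul, sub_mul, mul_sub, smul_mul_assoc, map_add, map_sub,
    LinearMap.map_smul_of_tower, Complex.add_re, Complex.sub_re, Complex.smul_re, smul_eq_mul]
  ring

lemma exists_tendsto_of_forall_mem_Icc (l : Ultrafilter ℝ) {v : ℝ → A}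
    (hv : ∀ e, v e ∈ Set.Icc (-1) 1) : ∃ v₀ ∈ Set.Icc (-1) 1, Tendsto v l (𝓝 v₀) :=
  isCompact_Icc_neg_one_one.ultrafilter_le_nhds' (l.map v)
    (Ultrafilter.mem_map.2 (Filter.univ_mem' hv))

omit [PartialOrder A] [StarOrderedRing A] in
lemma tendsto_re_map_mul (φ : A →ₗ[ℂ] ℂ) {l : Filter ℝ} (a : A) {v : ℝ → A} {v₀ : A}
    (hv : Tendsto v l (𝓝 v₀)) : Tendsto (fun e => (φ (a * v e)).re) l (𝓝 (φ (a * v₀)).re) :=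
  ((Complex.continuous_re.comp ((LinearMap.continuous_of_finiteDimensional φ).comp
    (continuous_const_mul a))).tendsto v₀).comp hv

namespace IsFaithfulTrace

lemma two_mul_traceNorm_add_le (hφ : IsFaithfulTrace φ) (hX : IsSelfAdjoint X)
    (hY : IsSelfAdjoint Y) (e : ℝ) :
    2 * traceNorm φ X + e * (2 * (φ (Y * specProj X 0)).re) ≤
      traceNorm φ (X + e • Y) + traceNorm φ (X - e • Y) := by
  have heY : IsSelfAdjoint (e • Y) := (IsSelfAdjoint.all e).smul hY
  have hplus := hφ.re_map_mul_le_traceNorm (hX.add heY)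
    (sgn_add_smul_specProj_mem_Icc hX (c := 1) (by simp))
  have hminus := hφ.re_map_mul_le_traceNorm (hX.sub heY)
    (sgn_add_smul_specProj_mem_Icc hX (c := -1) (by simp))
  rw [add_mul, map_add, Complex.add_re, re_map_mul_sgn_add_smul_specProj φ hX] at hplus
  rw [sub_mul, map_sub, Complex.sub_re, re_map_mul_sgn_add_smul_specProj φ hX] at hminus
  simp only [one_smul, neg_smul, mul_add, mul_neg, smul_mul_assoc, map_add, map_neg,
    LinearMap.map_smul_of_tower, Complex.add_re, Complex.neg_re, Complex.smul_re,
    smul_eq_mul] at hplus hminus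
  linarith

/-- The norming elements are limits of the signs of `X + e Y` and `X - e Y` as `e → 0`. -/
lemma exists_norming_of_second_difference (hφ : IsFaithfulTrace φ) (hX : IsSelfAdjoint X)
    (hY : IsSelfAdjoint Y) {c : ℝ}
    (h : ∀ e : ℝ, 0 < e →
      2 * traceNorm φ X + e * c ≤ traceNorm φ (X + e • Y) + traceNorm φ (X - e • Y)) :
    ∃ w ∈ Set.Icc (-1 : A) 1, ∃ u ∈ Set.Icc (-1 : A) 1,
      X * w = CFC.abs X ∧ X * u = CFC.abs X ∧ c ≤ (φ (Y * (w - u))).re := by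
  have heY (e : ℝ) : IsSelfAdjoint (e • Y) := (IsSelfAdjoint.all e).smul hY
  set w : ℝ → A := fun e => sgn (X + e • Y)
  set u : ℝ → A := fun e => sgn (X - e • Y)
  have hwI (e : ℝ) : w e ∈ Set.Icc (-1) 1 := sgn_mem_Icc (hX.add (heY e))
  have huI (e : ℝ) : u e ∈ Set.Icc (-1) 1 := sgn_mem_Icc (hX.sub (heY e))
  have hsum {e : ℝ} (he : 0 < e) : 2 * traceNorm φ X + e * c ≤
      (φ (X * w e)).re + (φ (X * u e)).re + e * (φ (Y * (w e - u e))).re :=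
    (h e he).trans_eq (traceNorm_add_smul_add_traceNorm_sub_smul φ hX hY e)
  have hdiff {e : ℝ} (he : 0 < e) : c ≤ (φ (Y * (w e - u e))).re := by
    have hwX := hφ.re_map_mul_le_traceNorm hX (hwI e)
    have huX := hφ.re_map_mul_le_traceNorm hX (huI e)
    exact le_of_mul_le_mul_left (by linarith [hsum he]) he
  let l : Ultrafilter ℝ := Ultrafilter.of (𝓝[>] 0)
  have hl : (l : Filter ℝ) ≤ 𝓝[>] 0 := Ultrafilter.of_le _
  have hlpos : ∀ᶠ e in (l : Filter ℝ), 0 < e := hl self_mem_nhdsWithin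
  have hl0 : Tendsto (fun e : ℝ => e) l (𝓝 0) := hl.trans nhdsWithin_le_nhds
  obtain ⟨w₀, hw₀, hwlim⟩ := exists_tendsto_of_forall_mem_Icc l hwI
  obtain ⟨u₀, hu₀, hulim⟩ := exists_tendsto_of_forall_mem_Icc l huI
  have hlimY := tendsto_re_map_mul φ Y (hwlim.sub hulim)
  have hlimX : 2 * traceNorm φ X ≤ (φ (X * w₀)).re + (φ (X * u₀)).re := by
    have hleft := (hl0.mul_const c).const_add (2 * traceNorm φ X)
    have hright := ((tendsto_re_map_mul φ X hwlim).add (tendsto_re_map_mul φ X hulim)).add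
      (hl0.mul hlimY)
    simpa using le_of_tendsto_of_tendsto hleft hright (hlpos.mono fun e he => hsum he)
  have hnormw := hφ.re_map_mul_le_traceNorm hX hw₀
  have hnormu := hφ.re_map_mul_le_traceNorm hX hu₀
  exact ⟨w₀, hw₀, u₀, hu₀, hφ.mul_eq_abs_of_re_map_mul_eq hX hw₀ (by linarith),
    hφ.mul_eq_abs_of_re_map_mul_eq hX hu₀ (by linarith),
    ge_of_tendsto hlimY (hlpos.mono fun e he => hdiff he)⟩

lemma le_of_second_difference (hφ : IsFaithfulTrace φ) (hX : IsSelfAdjoint X)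
    (hY : 0 ≤ Y) {c : ℝ}
    (h : ∀ e : ℝ, 0 < e →
      2 * traceNorm φ X + e * c ≤ traceNorm φ (X + e • Y) + traceNorm φ (X - e • Y)) :
    c ≤ 2 * (φ (Y * specProj X 0)).re := by
  obtain ⟨w, hw, u, hu, hXw, hXu, hc⟩ :=
    hφ.exists_norming_of_second_difference hX (IsSelfAdjoint.of_nonneg hY) h
  have hsa {v : A} (hv : v ∈ Set.Icc (-1 : A) 1) : IsSelfAdjoint v := by
    have := (IsSelfAdjoint.of_nonneg (sub_nonneg.2 hv.2))
    simpa using (IsSelfAdjoint.one A).sub this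
  have hle : w - u ≤ (2 : ℝ) • specProj X 0 := by
    refine le_smul_specProj_zero hX ((hsa hw).sub (hsa hu)) ?_ (by rw [mul_sub, hXw, hXu, sub_self])
    calc w - u ≤ 1 - -1 := sub_le_sub hw.2 hu.1
      _ = (2 : ℝ) • 1 := by rw [two_smul, sub_neg_eq_add]
  have := (Complex.le_def.1 (hφ.map_mul_nonneg hY (sub_nonneg.2 hle))).1
  simp only [mul_sub, map_sub, mul_smul_comm, LinearMap.map_smul_of_tower, Complex.sub_re,
    Complex.smul_re, Complex.zero_re, smul_eq_mul] at this hc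
  linarith

end IsFaithfulTrace

namespace IsTraceAdjoint

lemma map_specProj_zero_le (hT : IsTraceAdjoint φ ψ T Φ) (hΦ : IsUnitalSchwarz Φ)
    (hφ : IsFaithfulTrace φ) (hψ : IsFaithfulTrace ψ) (hX : IsSelfAdjoint X)
    (h : traceNorm φ X = traceNorm ψ (T X)) : Φ (specProj (T X) 0) ≤ specProj X 0 := by
  have hTX := hT.isSelfAdjoint_map hΦ hφ hψ hX
  have hk := isStarProjection_specProj (T X) 0
  have hnorming {c : ℝ} (hc : |c| ≤ 1) : X * Φ (sgn (T X) + c • specProj (T X) 0) = CFC.abs X := by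
    refine hφ.mul_eq_abs_of_re_map_mul_eq hX
      (hΦ.map_mem_Icc (sgn_add_smul_specProj_mem_Icc hTX hc)) ?_
    rw [← hT, re_map_mul_sgn_add_smul_specProj ψ hTX, h]
  have hzero : X * Φ (specProj (T X) 0) = 0 := by
    have hdiff := (hnorming (c := 1) (by simp)).trans (hnorming (c := 0) (by simp)).symm
    simpa [mul_add] using hdiff
  have hle : Φ (specProj (T X) 0) ≤ (1 : ℝ) • 1 := by
    rw [one_smul, ← hΦ.map_one]
    exact hΦ.mono hk.le_one
  simpa using le_smul_specProj_zero hX (IsSelfAdjoint.of_nonneg (hΦ.map_nonneg hk.nonneg)) hle hzero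

lemma map_specProj_zero (hT : IsTraceAdjoint φ ψ T Φ) (hΦ : IsUnitalSchwarz Φ)
    (hφ : IsFaithfulTrace φ) (hψ : IsFaithfulTrace ψ) (hX : IsSelfAdjoint X)
    (hY : IsStrictlyPositive Y)
    (h : ∀ e : ℝ, traceNorm φ (X + e • Y) = traceNorm ψ (T X + e • T Y)) :
    Φ (specProj (T X) 0) = specProj X 0 := by
  have h0 : traceNorm φ X = traceNorm ψ (T X) := by simpa using h 0
  have hle := hT.map_specProj_zero_le hΦ hφ hψ hX h0
  have hmass : 2 * (φ (Y * specProj X 0)).re ≤ 2 * (ψ (T Y * specProj (T X) 0)).re :=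
    hψ.le_of_second_difference (hT.isSelfAdjoint_map hΦ hφ hψ hX) (hT.map_nonneg hΦ hφ hψ hY.nonneg)
      fun e _ => by
        have hneg := h (-e)
        rw [neg_smul, neg_smul, ← sub_eq_add_neg, ← sub_eq_add_neg] at hneg
        rw [← h0, ← h e, ← hneg]
        exact hφ.two_mul_traceNorm_add_le hX (IsSelfAdjoint.of_nonneg hY.nonneg) e
  have hnn := hφ.map_mul_nonneg hY.nonneg (sub_nonneg.2 hle)
  have hzero : φ (Y * (specProj X 0 - Φ (specProj (T X) 0))) = 0 := by
    refine le_antisymm (Complex.le_def.2 ⟨?_, (Complex.le_def.1 hnn).2.symm⟩) hnn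
    rw [hT] at hmass
    rw [mul_sub, map_sub, Complex.sub_re, Complex.zero_re]
    linarith
  exact (sub_eq_zero.1
    (hφ.eq_zero_of_map_mul_of_isUnit hY.nonneg (sub_nonneg.2 hle) hY.isUnit hzero)).symm

end IsTraceAdjoint

end Pencil

section Powers

variable {A B E : Type*} [CStarAlgebra A] [FiniteDimensional ℂ A] [PartialOrder A]
  [StarOrderedRing A] [CStarAlgebra B] [FiniteDimensional ℂ B] [PartialOrder B] [StarOrderedRing B]
  [AddCommGroup E] [Module ℂ E]

/-- The power `ρ ^ z` of a strictly positive element, with a complex exponent `z`. -/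
noncomputable def opPow (ρ : A) (z : ℂ) : A := cfc (fun w : ℂ => w ^ z) ρ

variable {ρ : A} {ρ' : B}

omit [FiniteDimensional ℂ A] in
lemma exists_pos_of_mem_spectrum (hρ : IsStrictlyPositive ρ) {w : ℂ} (hw : w ∈ spectrum ℂ ρ) :
    ∃ r : ℝ, 0 < r ∧ w = r := by
  have hre := hρ.isSelfAdjoint.mem_spectrum_eq_re hw
  refine ⟨w.re, hρ.spectrum_pos (𝕜 := ℝ) ?_, hre⟩
  rw [← spectrum.preimage_algebraMap ℂ]
  simpa [← hre] using hw

lemma opPow_add (hρ : IsStrictlyPositive ρ) (z w : ℂ) :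
    opPow ρ (z + w) = opPow ρ z * opPow ρ w := by
  rw [opPow, opPow, opPow, ← cfc_mul _ _ ρ (continuousOn_spectrum_complex _ _)
    (continuousOn_spectrum_complex _ _)]
  refine cfc_congr fun x hx => ?_
  obtain ⟨r, hr, rfl⟩ := exists_pos_of_mem_spectrum hρ hx
  exact Complex.cpow_add _ _ (by exact_mod_cast hr.ne')

omit [FiniteDimensional ℂ A] in
lemma opPow_zero (hρ : IsStrictlyPositive ρ) : opPow ρ 0 = 1 := by
  have : IsStarNormal ρ := hρ.isSelfAdjoint.isStarNormal
  rw [opPow, ← cfc_one ℂ ρ]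
  exact cfc_congr fun x _ => by simp

omit [FiniteDimensional ℂ A] in
lemma opPow_one (hρ : IsStrictlyPositive ρ) : opPow ρ 1 = ρ := by
  have : IsStarNormal ρ := hρ.isSelfAdjoint.isStarNormal
  conv_rhs => rw [← cfc_id' ℂ ρ]
  exact cfc_congr fun x _ => by simp

lemma opPow_mul_opPow_neg (hρ : IsStrictlyPositive ρ) (z : ℂ) :
    opPow ρ z * opPow ρ (-z) = 1 := by
  rw [← opPow_add hρ, add_neg_cancel, opPow_zero hρ]

lemma opPow_neg_mul_opPow (hρ : IsStrictlyPositive ρ) (z : ℂ) :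
    opPow ρ (-z) * opPow ρ z = 1 := by
  rw [← opPow_add hρ, neg_add_cancel, opPow_zero hρ]

lemma opPow_neg_one_mul_self (hρ : IsStrictlyPositive ρ) : opPow ρ (-1) * ρ = 1 := by
  simpa only [opPow_one hρ] using opPow_neg_mul_opPow hρ 1

lemma mul_opPow_neg_one (hρ : IsStrictlyPositive ρ) : ρ * opPow ρ (-1) = 1 := by
  simpa only [opPow_one hρ] using opPow_mul_opPow_neg hρ 1

lemma opPow_half_mul_opPow_half (hρ : IsStrictlyPositive ρ) :
    opPow ρ (1 / 2) * opPow ρ (1 / 2) = ρ := by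
  rw [← opPow_add hρ, add_halves, opPow_one hρ]

lemma mul_opPow_neg_half (hρ : IsStrictlyPositive ρ) :
    ρ * opPow ρ (-(1 / 2)) = opPow ρ (1 / 2) := by
  nth_rewrite 1 [← opPow_half_mul_opPow_half hρ]
  rw [mul_assoc, opPow_mul_opPow_neg hρ, mul_one]

omit [FiniteDimensional ℂ A] in
lemma star_opPow (hρ : IsStrictlyPositive ρ) (z : ℂ) : star (opPow ρ z) = opPow ρ (star z) := by
  rw [opPow, opPow, ← cfc_star]
  refine cfc_congr fun x hx => ?_
  obtain ⟨r, hr, rfl⟩ := exists_pos_of_mem_spectrum hρ hx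
  have h := Complex.cpow_conj (r : ℂ) z
    (by rw [Complex.arg_ofReal_of_nonneg hr.le]; exact Real.pi_ne_zero.symm)
  rw [Complex.conj_ofReal] at h
  exact h.symm

lemma opPow_mul_specProj (hρ : IsStrictlyPositive ρ) (z : ℂ) (r : ℝ) :
    opPow ρ z * specProj ρ r = (r : ℂ) ^ z • specProj ρ r := by
  rw [opPow, specProj, cfc_real_eq_complex _ hρ.isSelfAdjoint,
    ← cfc_mul _ _ ρ (continuousOn_spectrum_complex _ ρ) (continuousOn_spectrum_complex _ ρ),
    ← cfc_smul _ _ ρ (continuousOn_spectrum_complex _ ρ)]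
  refine cfc_congr fun x hx => ?_
  obtain ⟨s, -, rfl⟩ := exists_pos_of_mem_spectrum hρ hx
  by_cases h : s = r <;> simp [h]

lemma specProj_mul_opPow (hρ : IsStrictlyPositive ρ) (z : ℂ) (r : ℝ) :
    specProj ρ r * opPow ρ z = (r : ℂ) ^ z • specProj ρ r := by
  rw [← opPow_mul_specProj hρ, opPow, specProj, cfc_real_eq_complex _ hρ.isSelfAdjoint]
  exact cfc_commute_cfc _ _ ρ

/-- The powers `a ↦ ρ ^ z a ρ ^ (-z)` of the modular operator of `ρ`. -/
noncomputable def modularMap (ρ : A) (z : ℂ) : Module.End ℂ A :=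
  LinearMap.mulLeftRight ℂ (opPow ρ z, opPow ρ (-z))

omit [FiniteDimensional ℂ A] [PartialOrder A] [StarOrderedRing A] in
lemma modularMap_apply (ρ : A) (z : ℂ) (a : A) :
    modularMap ρ z a = opPow ρ z * a * opPow ρ (-z) := rfl

omit [FiniteDimensional ℂ A] in
lemma modularMap_zero (hρ : IsStrictlyPositive ρ) : modularMap ρ 0 = 1 := by
  ext a
  simp only [modularMap_apply, neg_zero, opPow_zero hρ, one_mul, mul_one, Module.End.one_apply]

lemma modularMap_add (hρ : IsStrictlyPositive ρ) (z w : ℂ) :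
    modularMap ρ (z + w) = modularMap ρ z * modularMap ρ w := by
  ext a
  rw [Module.End.mul_apply]
  simp only [modularMap_apply, neg_add_rev, opPow_add hρ, mul_assoc]

lemma modularMap_natCast_mul (hρ : IsStrictlyPositive ρ) (n : ℕ) (w : ℂ) :
    modularMap ρ (n * w) = modularMap ρ w ^ n := by
  induction n with
  | zero => rw [Nat.cast_zero, zero_mul, modularMap_zero hρ, pow_zero]
  | succ n ih => rw [Nat.cast_succ, add_one_mul, modularMap_add hρ, ih, pow_succ]

lemma modularMap_mul_opPow (hρ : IsStrictlyPositive ρ) (z : ℂ) (a : A) :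
    modularMap ρ z a * opPow ρ z = opPow ρ z * a := by
  rw [modularMap_apply, mul_assoc, opPow_neg_mul_opPow hρ, mul_one]

lemma eq_modularMap_iff (hρ : IsStrictlyPositive ρ) {z : ℂ} {a b : A} :
    b = modularMap ρ z a ↔ b * opPow ρ z = opPow ρ z * a := by
  refine ⟨fun h => h ▸ modularMap_mul_opPow hρ z a, fun h => ?_⟩
  rw [modularMap_apply, ← h, mul_assoc, opPow_mul_opPow_neg hρ, mul_one]

lemma modularMap_mul (hρ : IsStrictlyPositive ρ) (z : ℂ) (a b : A) :
    modularMap ρ z (a * b) = modularMap ρ z a * modularMap ρ z b := by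
  simp only [modularMap_apply, mul_assoc]
  rw [← mul_assoc (opPow ρ (-z)), opPow_neg_mul_opPow hρ, one_mul]

lemma modularMap_of_commute (hρ : IsStrictlyPositive ρ) {a : A} (h : Commute a ρ) (z : ℂ) :
    modularMap ρ z a = a := by
  have hcomm : Commute a (opPow ρ z) := (hρ.isSelfAdjoint.commute_cfc h.symm _).symm
  rw [modularMap_apply, ← hcomm.eq, mul_assoc, opPow_mul_opPow_neg hρ, mul_one]

lemma modularMap_specProj_mul_mul_specProj (hρ : IsStrictlyPositive ρ) {r s : ℝ} (hr : 0 < r)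
    (hs : 0 < s) (z : ℂ) (a : A) :
    modularMap ρ z (specProj ρ r * a * specProj ρ s) =
      ((r / s : ℝ) : ℂ) ^ z • (specProj ρ r * a * specProj ρ s) := by
  have hpow : ((r / s : ℝ) : ℂ) ^ z = (r : ℂ) ^ z * (s : ℂ) ^ (-z) := by
    rw [div_eq_mul_inv, Complex.ofReal_mul, Complex.mul_cpow_ofReal_nonneg hr.le (inv_pos.2 hs).le,
      Complex.ofReal_inv, Complex.inv_cpow_ofReal_nonneg hs.le, Complex.cpow_neg]
  calc modularMap ρ z (specProj ρ r * a * specProj ρ s)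
      = (opPow ρ z * specProj ρ r) * a * (specProj ρ s * opPow ρ (-z)) := by
        simp only [modularMap_apply, mul_assoc]
    _ = ((r / s : ℝ) : ℂ) ^ z • (specProj ρ r * a * specProj ρ s) := by
        rw [opPow_mul_specProj hρ, specProj_mul_opPow hρ, hpow]
        simp only [smul_mul_assoc, mul_smul_comm, smul_smul, mul_comm]

lemma aeval_modularMap (hρ : IsStrictlyPositive ρ) {p : Polynomial ℂ} {w z : ℂ}
    (hp : ∀ x ∈ spectrum ℝ ρ / spectrum ℝ ρ, p.eval ((x : ℂ) ^ w) = (x : ℂ) ^ z) :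
    aeval (modularMap ρ w) p = modularMap ρ z := by
  ext a
  have ha : a = ∑ r ∈ (finite_spectrum_real ρ).toFinset, ∑ s ∈ (finite_spectrum_real ρ).toFinset,
      specProj ρ r * a * specProj ρ s := by
    simp only [← Finset.mul_sum, ← Finset.sum_mul, sum_specProj hρ.isSelfAdjoint, one_mul, mul_one]
  rw [ha]
  simp only [map_sum]
  refine Finset.sum_congr rfl fun r hr => Finset.sum_congr rfl fun s hs => ?_
  rw [Set.Finite.mem_toFinset] at hr hs
  have hr0 := hρ.spectrum_pos hr
  have hs0 := hρ.spectrum_pos hs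
  rw [Module.End.aeval_apply_of_mem_apply_eq_smul
      (modularMap_specProj_mul_mul_specProj hρ hr0 hs0 w a), hp _ (Set.div_mem_div hr hs),
    modularMap_specProj_mul_mul_specProj hρ hr0 hs0]

/-- By Lagrange interpolation on the ratios of eigenvalues, every power of the modular operators of
`ρ` and `ρ'` is the same polynomial in their `w`-th powers. -/
lemma map_modularMap_eq (hρ : IsStrictlyPositive ρ) (hρ' : IsStrictlyPositive ρ') {w : ℂ}
    (hw : Set.InjOn (fun x : ℝ => (x : ℂ) ^ w)
      (spectrum ℝ ρ / spectrum ℝ ρ ∪ spectrum ℝ ρ' / spectrum ℝ ρ'))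
    {f : A →ₗ[ℂ] E} {g : B →ₗ[ℂ] E} {a : A} {b : B}
    (h : ∀ n : ℕ, f (modularMap ρ (n * w) a) = g (modularMap ρ' (n * w) b)) (z : ℂ) :
    f (modularMap ρ z a) = g (modularMap ρ' z b) := by
  set F := spectrum ℝ ρ / spectrum ℝ ρ ∪ spectrum ℝ ρ' / spectrum ℝ ρ'
  have hF : F.Finite := ((finite_spectrum_real ρ).div (finite_spectrum_real ρ)).union
    ((finite_spectrum_real ρ').div (finite_spectrum_real ρ'))
  obtain ⟨p, hp⟩ : ∃ p : Polynomial ℂ, ∀ x ∈ F, p.eval ((x : ℂ) ^ w) = (x : ℂ) ^ z :=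
    ⟨Lagrange.interpolate hF.toFinset (fun x : ℝ => (x : ℂ) ^ w) fun x => (x : ℂ) ^ z,
      fun x hx => Lagrange.eval_interpolate_at_node _ (by rwa [hF.coe_toFinset])
        (hF.mem_toFinset.2 hx)⟩
  rw [← aeval_modularMap hρ fun x hx => hp x (Or.inl hx),
    ← aeval_modularMap hρ' fun x hx => hp x (Or.inr hx), Polynomial.aeval_eq_sum_range,
    Polynomial.aeval_eq_sum_range]
  simp only [LinearMap.sum_apply, LinearMap.smul_apply, map_sum, map_smul,
    ← modularMap_natCast_mul hρ, ← modularMap_natCast_mul hρ', h]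

lemma modularMap_mem (hρ : IsStrictlyPositive ρ) {w : ℂ}
    (hw : Set.InjOn (fun x : ℝ => (x : ℂ) ^ w) (spectrum ℝ ρ / spectrum ℝ ρ))
    {N : Submodule ℂ A} {a : A} (h : ∀ n : ℕ, modularMap ρ (n * w) a ∈ N) (z : ℂ) :
    modularMap ρ z a ∈ N := by
  rw [← Submodule.Quotient.mk_eq_zero, ← Submodule.mkQ_apply,
    map_modularMap_eq hρ hρ (by rwa [Set.union_self]) (g := 0) (b := 0) (w := w) fun n => by
      simpa using h n]
  simp

/-- For small `s` the numbers `s * log x` stay in `(-π, π)`, where `exp (i ·)` is injective. -/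
lemma exists_injOn_cpow_I_mul {F : Set ℝ} (hF : F.Finite) (hpos : ∀ x ∈ F, 0 < x) :
    ∃ s : ℝ, Set.InjOn (fun x : ℝ => (x : ℂ) ^ (Complex.I * s)) F := by
  obtain ⟨M, hM⟩ := (hF.image fun x => |Real.log x|).bddAbove
  have hM0 : 0 < |M| + 1 := by positivity
  set s := (|M| + 1)⁻¹
  have hs : 0 < s := inv_pos.2 hM0
  have hlog {x : ℝ} (hx : x ∈ F) : |s * Real.log x| < 1 := by
    rw [abs_mul, abs_of_pos hs, inv_mul_lt_one₀ hM0]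
    exact (hM (Set.mem_image_of_mem _ hx)).trans_lt ((le_abs_self M).trans_lt (lt_add_one _))
  have hexp {x : ℝ} (hx : x ∈ F) :
      (x : ℂ) ^ (Complex.I * s) = Complex.exp (↑(s * Real.log x) * Complex.I) := by
    rw [Complex.cpow_def_of_ne_zero (by exact_mod_cast (hpos x hx).ne'), ← Complex.ofReal_log
      (hpos x hx).le, Complex.ofReal_mul]
    ring_nf
  refine ⟨s, fun x hx y hy hxy => ?_⟩
  have him {x : ℝ} (hx : x ∈ F) : -Real.pi < s * Real.log x ∧ s * Real.log x ≤ Real.pi :=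
    ⟨by linarith [(abs_lt.1 (hlog hx)).1, Real.pi_gt_three],
      by linarith [(abs_lt.1 (hlog hx)).2, Real.pi_gt_three]⟩
  have h : (↑(s * Real.log x) * Complex.I) = ↑(s * Real.log y) * Complex.I :=
    Complex.exp_inj_of_neg_pi_lt_of_le_pi (by simpa using (him hx).1) (by simpa using (him hx).2)
      (by simpa using (him hy).1) (by simpa using (him hy).2)
      (by rw [← hexp hx, ← hexp hy]; exact hxy)
  have h' : s * Real.log x = s * Real.log y :=
    Complex.ofReal_injective (mul_right_cancel₀ Complex.I_ne_zero h)
  exact Real.log_injOn_pos (hpos x hx) (hpos y hy) (mul_left_cancel₀ hs.ne' h')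

lemma modularMap_mem_of_forall_real (hρ : IsStrictlyPositive ρ) {N : Submodule ℂ A} {a : A}
    (h : ∀ s : ℝ, modularMap ρ (Complex.I * s) a ∈ N) (z : ℂ) : modularMap ρ z a ∈ N := by
  obtain ⟨s, hs⟩ := exists_injOn_cpow_I_mul
    ((finite_spectrum_real ρ).div (finite_spectrum_real ρ)) (by
      rintro _ ⟨r, hr, r', hr', rfl⟩
      exact div_pos (hρ.spectrum_pos hr) (hρ.spectrum_pos hr'))
  refine modularMap_mem hρ hs (fun n => ?_) z
  convert h (n * s) using 3
  push_cast
  ring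

lemma modularMap_mem_of_modularMap_one_mem (hρ : IsStrictlyPositive ρ) {N : Submodule ℂ A}
    (hN : ∀ a ∈ N, modularMap ρ 1 a ∈ N) {a : A} (ha : a ∈ N) (z : ℂ) : modularMap ρ z a ∈ N := by
  refine modularMap_mem hρ (w := 1) (by simp) (fun n => ?_) z
  rw [modularMap_natCast_mul hρ]
  exact Module.End.pow_apply_mem_of_forall_mem n hN a ha

lemma exists_starAlgEquiv_modularMap (hρ : IsStrictlyPositive ρ) (s : ℝ) :
    ∃ α : A ≃⋆ₐ[ℂ] A, ∀ a, α a = modularMap ρ (Complex.I * s) a := by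
  have hstar : star (opPow ρ (Complex.I * s)) = opPow ρ (-(Complex.I * s)) := by
    rw [star_opPow hρ]
    congr 1
    simp
  refine ⟨Unitary.conjStarAlgAut ℂ A ⟨opPow ρ (Complex.I * s), ?_⟩, fun a => ?_⟩
  · rw [Unitary.mem_iff, hstar, opPow_neg_mul_opPow hρ, opPow_mul_opPow_neg hρ]
    exact ⟨rfl, rfl⟩
  · rw [Unitary.conjStarAlgAut_apply, modularMap_apply]
    exact congrArg _ hstar

lemma modularMap_I_mul_nonneg (hρ : IsStrictlyPositive ρ) (s : ℝ) {a : A} (ha : 0 ≤ a) :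
    0 ≤ modularMap ρ (Complex.I * s) a := by
  obtain ⟨α, hα⟩ := exists_starAlgEquiv_modularMap hρ s
  exact hα a ▸ map_nonneg α ha

lemma modularMap_specProj (hρ : IsStrictlyPositive ρ) (s : ℝ) {a : A} (ha : IsSelfAdjoint a)
    (r : ℝ) : modularMap ρ (Complex.I * s) (specProj a r) =
      specProj (modularMap ρ (Complex.I * s) a) r := by
  obtain ⟨α, hα⟩ := exists_starAlgEquiv_modularMap hρ s
  have hcont : Continuous α := by
    exact LinearMap.continuous_of_finiteDimensional (α : A →ₗ[ℂ] A)
  rw [← hα, ← hα]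
  exact StarAlgHomClass.map_cfc (S := ℂ) α _ a (continuousOn_spectrum_real _ a) hcont ha (ha.map α)

end Powers

section DualMap

variable {A B : Type*} [CStarAlgebra A] [FiniteDimensional ℂ A] [PartialOrder A]
  [StarOrderedRing A] [CStarAlgebra B] [FiniteDimensional ℂ B] [PartialOrder B] [StarOrderedRing B]
  {φ : A →ₗ[ℂ] ℂ} {ψ : B →ₗ[ℂ] ℂ} {T : A →ₗ[ℂ] B} {Φ : B →ₗ[ℂ] A} {ρ : A}

/-- The dual map `T_ρ` with respect to `ρ`, a noncommutative Bayesian inverse of the trace adjoint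
of `T`. -/
noncomputable def dualMap (T : A →ₗ[ℂ] B) (ρ : A) : A →ₗ[ℂ] B :=
  LinearMap.mulLeftRight ℂ (opPow (T ρ) (-(1 / 2)), opPow (T ρ) (-(1 / 2))) ∘ₗ T ∘ₗ
    LinearMap.mulLeftRight ℂ (opPow ρ (1 / 2), opPow ρ (1 / 2))

omit [FiniteDimensional ℂ A] [PartialOrder A] [StarOrderedRing A] [FiniteDimensional ℂ B]
  [PartialOrder B] [StarOrderedRing B] in
lemma dualMap_apply (T : A →ₗ[ℂ] B) (ρ a : A) : dualMap T ρ a =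
    opPow (T ρ) (-(1 / 2)) * T (opPow ρ (1 / 2) * a * opPow ρ (1 / 2)) *
      opPow (T ρ) (-(1 / 2)) := rfl

/-- The recovery map of Petz: the trace adjoint of `dualMap T ρ`, expressed by the trace
adjoint `Φ` of `T`. -/
noncomputable def petzMap (T : A →ₗ[ℂ] B) (Φ : B →ₗ[ℂ] A) (ρ : A) : B →ₗ[ℂ] A :=
  LinearMap.mulLeftRight ℂ (opPow ρ (1 / 2), opPow ρ (1 / 2)) ∘ₗ Φ ∘ₗ
    LinearMap.mulLeftRight ℂ (opPow (T ρ) (-(1 / 2)), opPow (T ρ) (-(1 / 2)))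

omit [FiniteDimensional ℂ A] [PartialOrder A] [StarOrderedRing A] [FiniteDimensional ℂ B]
  [PartialOrder B] [StarOrderedRing B] in
lemma petzMap_apply (T : A →ₗ[ℂ] B) (Φ : B →ₗ[ℂ] A) (ρ : A) (b : B) : petzMap T Φ ρ b =
    opPow ρ (1 / 2) * Φ (opPow (T ρ) (-(1 / 2)) * b * opPow (T ρ) (-(1 / 2))) *
      opPow ρ (1 / 2) := rfl

omit [FiniteDimensional ℂ A] [StarOrderedRing A] [FiniteDimensional ℂ B] [PartialOrder B]
  [StarOrderedRing B] [PartialOrder A] in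
lemma isTraceAdjoint_petzMap (hT : IsTraceAdjoint φ ψ T Φ) (hφ : IsFaithfulTrace φ)
    (hψ : IsFaithfulTrace ψ) : IsTraceAdjoint ψ φ (petzMap T Φ ρ) (dualMap T ρ) := fun b a => by
  set r := opPow ρ (1 / 2)
  set s := opPow (T ρ) (-(1 / 2))
  calc φ (r * Φ (s * b * s) * r * a) = φ (r * a * r * Φ (s * b * s)) := by
        rw [mul_assoc _ r, hφ.map_mul_comm, ← mul_assoc]
    _ = ψ (T (r * a * r) * (s * b * s)) := (hT _ _).symm
    _ = ψ (b * (s * T (r * a * r) * s)) := by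
        rw [← mul_assoc, hψ.map_mul_comm, ← mul_assoc, ← mul_assoc, ← mul_assoc,
          hψ.map_mul_comm]
        simp only [mul_assoc]

lemma petzMap_map_self (hΦ : Φ 1 = 1) (hρ : IsStrictlyPositive ρ)
    (hTρ : IsStrictlyPositive (T ρ)) : petzMap T Φ ρ (T ρ) = ρ := by
  rw [petzMap_apply]
  nth_rewrite 2 [← opPow_half_mul_opPow_half hTρ]
  rw [← mul_assoc, opPow_neg_mul_opPow hTρ, one_mul, opPow_mul_opPow_neg hTρ, hΦ, mul_one,
    opPow_half_mul_opPow_half hρ]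

namespace IsTraceAdjoint

lemma eq_modularMap_one (hT : IsTraceAdjoint φ ψ T Φ) (hφ : IsFaithfulTrace φ)
    (hψ : IsFaithfulTrace ψ) (hρ : IsStrictlyPositive ρ) (hTρ : IsStrictlyPositive (T ρ))
    {m n : B} (hm : m ∈ multDomain Φ) (hn : n ∈ multDomain Φ)
    (h : Φ n = modularMap ρ 1 (Φ m)) : n = modularMap (T ρ) 1 m := by
  rw [eq_modularMap_iff hρ, opPow_one hρ] at h
  rw [eq_modularMap_iff hTρ, opPow_one hTρ, ← hT.map_map_mul_of_mem_multDomain hφ hψ hn, h,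
    hT.map_mul_map_of_mem_multDomain hψ hm]

lemma map_modularMap (hT : IsTraceAdjoint φ ψ T Φ) (hφ : IsFaithfulTrace φ)
    (hψ : IsFaithfulTrace ψ) (hρ : IsStrictlyPositive ρ) (hTρ : IsStrictlyPositive (T ρ))
    {m : B} (hm : m ∈ multDomain Φ) (h : ∀ z, modularMap ρ z (Φ m) ∈ (multDomain Φ).map Φ) (z : ℂ) :
    Φ (modularMap (T ρ) z m) = modularMap ρ z (Φ m) := by
  have hnat (n : ℕ) : modularMap (T ρ) n m ∈ multDomain Φ ∧
      Φ (modularMap (T ρ) n m) = modularMap ρ n (Φ m) := by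
    induction n with
    | zero => simpa [modularMap_zero hρ, modularMap_zero hTρ] using hm
    | succ n ih =>
      obtain ⟨k, hk, hk'⟩ := h (n + 1)
      have hsucc : k = modularMap (T ρ) (n + 1) m := by
        rw [add_comm, modularMap_add hTρ]
        refine hT.eq_modularMap_one hφ hψ hρ hTρ ih.1 hk ?_
        rw [ih.2, hk', add_comm, modularMap_add hρ, Module.End.mul_apply]
      rw [Nat.cast_succ, ← hsucc]
      exact ⟨hk, hk'⟩
  exact map_modularMap_eq (f := Φ) (g := LinearMap.id) (w := 1) hTρ hρ (by simp)
    (fun n => by simpa using (hnat n).2) z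

/-- If `Φ m = ρ ^ (1/2) a ρ ^ (-1/2)`, then `T_ρ a = T(ρ) ^ (-1/2) m T(ρ) ^ (1/2)`, and `Φ`
intertwines the modular maps. -/
lemma map_dualMap_of_modularMap_mem (hT : IsTraceAdjoint φ ψ T Φ) (hφ : IsFaithfulTrace φ)
    (hψ : IsFaithfulTrace ψ) (hρ : IsStrictlyPositive ρ) (hTρ : IsStrictlyPositive (T ρ)) {a : A}
    (h : ∀ s : ℝ, modularMap ρ (Complex.I * s) a ∈ (multDomain Φ).map Φ) :
    Φ (dualMap T ρ a) = a := by
  have hall := modularMap_mem_of_forall_real hρ h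
  obtain ⟨m, hm, hma⟩ := hall (1 / 2)
  have hdual : dualMap T ρ a = modularMap (T ρ) (-(1 / 2)) m := by
    have : opPow ρ (1 / 2) * a * opPow ρ (1 / 2) = Φ m * ρ := by
      rw [← modularMap_mul_opPow hρ, mul_assoc, opPow_half_mul_opPow_half hρ, hma]
    rw [dualMap_apply, this, hT.map_map_mul_of_mem_multDomain hφ hψ hm, modularMap_apply,
      neg_neg, mul_assoc, mul_assoc, mul_opPow_neg_half hTρ, mul_assoc]
  rw [hdual, hT.map_modularMap hφ hψ hρ hTρ hm (fun z => ?_), hma, ← Module.End.mul_apply,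
    ← modularMap_add hρ, neg_add_cancel, modularMap_zero hρ, Module.End.one_apply]
  rw [hma, ← Module.End.mul_apply, ← modularMap_add hρ]
  exact hall _

end IsTraceAdjoint

end DualMap

section FixedPoints

variable {A : Type*} [CStarAlgebra A] [PartialOrder A] [StarOrderedRing A]
  {φ : A →ₗ[ℂ] ℂ} {L Ψ : A →ₗ[ℂ] A} {ρ : A}

namespace IsTraceAdjoint

lemma map_star_mul_self_of_fixed (hL : IsTraceAdjoint φ φ L Ψ) (hΨ : IsUnitalSchwarz Ψ)
    (hφ : IsFaithfulTrace φ) (hρ : IsStrictlyPositive ρ) (hLρ : L ρ = ρ) {f : A} (hf : Ψ f = f) :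
    Ψ (star f * f) = star f * f := by
  refine sub_eq_zero.1 (hφ.eq_zero_of_map_mul_of_isUnit hρ.nonneg ?_ hρ.isUnit ?_)
  · simpa only [hf, sub_nonneg] using hΨ.star_mul_le f
  · rw [mul_sub, map_sub, ← hL, hLρ, sub_self]

lemma mem_multDomain_of_fixed (hL : IsTraceAdjoint φ φ L Ψ) (hΨ : IsUnitalSchwarz Ψ)
    (hφ : IsFaithfulTrace φ) (hρ : IsStrictlyPositive ρ) (hLρ : L ρ = ρ) {f : A} (hf : Ψ f = f) :
    f ∈ multDomain Ψ := by
  have hf' : Ψ (star f) = star f := by rw [hΨ.map_star, hf]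
  apply hΨ.mem_multDomain
  · rw [hL.map_star_mul_self_of_fixed hΨ hφ hρ hLρ hf, hf]
  · simpa only [hf, star_star] using hL.map_star_mul_self_of_fixed hΨ hφ hρ hLρ hf'

lemma map_mul_of_fixed (hL : IsTraceAdjoint φ φ L Ψ) (hΨ : IsUnitalSchwarz Ψ)
    (hφ : IsFaithfulTrace φ) (hρ : IsStrictlyPositive ρ) (hLρ : L ρ = ρ) {f : A} (hf : Ψ f = f)
    (a : A) : L (f * a) = f * L a := by
  simpa only [hf] using hL.map_map_mul_of_mem_multDomain hφ hφ
    (hL.mem_multDomain_of_fixed hΨ hφ hρ hLρ hf) a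

lemma map_mul_of_fixed_right (hL : IsTraceAdjoint φ φ L Ψ) (hΨ : IsUnitalSchwarz Ψ)
    (hφ : IsFaithfulTrace φ) (hρ : IsStrictlyPositive ρ) (hLρ : L ρ = ρ) {f : A} (hf : Ψ f = f)
    (a : A) : L (a * f) = L a * f := by
  simpa only [hf] using hL.map_mul_map_of_mem_multDomain hφ
    (hL.mem_multDomain_of_fixed hΨ hφ hρ hLρ hf) a

variable [FiniteDimensional ℂ A]

omit [PartialOrder A] [StarOrderedRing A] in
lemma finrank_ker_sub_one_le (hL : IsTraceAdjoint φ φ L Ψ) (hφ : IsFaithfulTrace φ) :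
    Module.finrank ℂ (LinearMap.ker (L - 1)) ≤ Module.finrank ℂ (LinearMap.ker (Ψ - 1)) := by
  set τ : A →ₗ[ℂ] Module.Dual ℂ A := (LinearMap.mul ℂ A).compr₂ φ
  have hτ : Function.Injective τ := fun a b h => hφ.ext fun x => LinearMap.congr_fun h x
  have hker : (LinearMap.ker (L - 1)).map τ ≤ (LinearMap.range (Ψ - 1)).dualAnnihilator := by
    rintro _ ⟨a, ha, rfl⟩
    rw [← LinearMap.ker_dualMap_eq_dualAnnihilator_range, LinearMap.mem_ker]
    ext x
    have ha' : L a = a := sub_eq_zero.1 ha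
    change φ (a * (Ψ x - x)) = 0
    rw [mul_sub, map_sub, ← hL, ha', sub_self]
  have hle := Submodule.finrank_mono hker
  rw [← (Submodule.equivMapOfInjective τ hτ _).finrank_eq] at hle
  have h₁ := Subspace.finrank_add_finrank_dualAnnihilator_eq (LinearMap.range (Ψ - 1))
  have h₂ := (Ψ - 1).finrank_range_add_finrank_ker
  omega

/-- Right multiplication by `ρ` maps the fixed points of `Ψ` injectively to those of `L`, and the
dimensions agree. -/
lemma exists_fixed_mul_eq (hL : IsTraceAdjoint φ φ L Ψ) (hΨ : IsUnitalSchwarz Ψ)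
    (hφ : IsFaithfulTrace φ) (hρ : IsStrictlyPositive ρ) (hLρ : L ρ = ρ) {a : A} (ha : L a = a) :
    ∃ f, Ψ f = f ∧ f * ρ = a := by
  have hinj : Function.Injective (LinearMap.mulRight ℂ ρ) := fun x y h =>
    hρ.isUnit.mul_left_injective h
  have hle : (LinearMap.ker (Ψ - 1)).map (LinearMap.mulRight ℂ ρ) ≤ LinearMap.ker (L - 1) := by
    rintro _ ⟨f, hf, rfl⟩
    exact sub_eq_zero.2 (by
      simp [hL.map_mul_of_fixed hΨ hφ hρ hLρ (sub_eq_zero.1 hf), hLρ])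
  have heq := Submodule.eq_of_le_of_finrank_le hle (by
    rw [← (Submodule.equivMapOfInjective _ hinj _).finrank_eq]
    exact hL.finrank_ker_sub_one_le hφ)
  have hmem : a ∈ LinearMap.ker (L - 1) := sub_eq_zero.2 ha
  obtain ⟨f, hf, hfa⟩ := heq ▸ hmem
  exact ⟨f, sub_eq_zero.1 hf, hfa⟩

lemma modularMap_one_fixed (hL : IsTraceAdjoint φ φ L Ψ) (hΨ : IsUnitalSchwarz Ψ)
    (hφ : IsFaithfulTrace φ) (hρ : IsStrictlyPositive ρ) (hLρ : L ρ = ρ) {f : A} (hf : Ψ f = f) :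
    Ψ (modularMap ρ 1 f) = modularMap ρ 1 f := by
  obtain ⟨g, hg, hgf⟩ := hL.exists_fixed_mul_eq hΨ hφ hρ hLρ (a := ρ * f)
    (by rw [hL.map_mul_of_fixed_right hΨ hφ hρ hLρ hf, hLρ])
  rwa [← (eq_modularMap_iff hρ).2 (by rwa [opPow_one hρ])]

lemma map_modularMap_of_fixed (hL : IsTraceAdjoint φ φ L Ψ) (hΨ : IsUnitalSchwarz Ψ)
    (hφ : IsFaithfulTrace φ) (hρ : IsStrictlyPositive ρ) (hLρ : L ρ = ρ) {a : A} (ha : L a = a)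
    (z : ℂ) : L (modularMap ρ z a) = modularMap ρ z a := by
  obtain ⟨f, hf, rfl⟩ := hL.exists_fixed_mul_eq hΨ hφ hρ hLρ ha
  have hfz : modularMap ρ z f ∈ LinearMap.ker (Ψ - 1) :=
    modularMap_mem_of_modularMap_one_mem hρ (fun g hg => sub_eq_zero.2
      (hL.modularMap_one_fixed hΨ hφ hρ hLρ (sub_eq_zero.1 hg))) (sub_eq_zero.2 hf) z
  rw [modularMap_mul hρ, modularMap_of_commute hρ (Commute.refl ρ),
    hL.map_mul_of_fixed hΨ hφ hρ hLρ (sub_eq_zero.1 hfz), hLρ]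

end IsTraceAdjoint

end FixedPoints

section Reversibility

variable {A B : Type*} [CStarAlgebra A] [PartialOrder A] [StarOrderedRing A]
  [CStarAlgebra B] [PartialOrder B] [StarOrderedRing B]
  {φ : A →ₗ[ℂ] ℂ} {ψ : B →ₗ[ℂ] ℂ} {T : A →ₗ[ℂ] B} {Φ : B →ₗ[ℂ] A} {ρ σ τ : A} {S : Set A}

/-- Some map `R` whose trace adjoint is a unital Schwarz map undoes `T` on `S`. -/
def IsReversible (φ : A →ₗ[ℂ] ℂ) (ψ : B →ₗ[ℂ] ℂ) (T : A →ₗ[ℂ] B) (S : Set A) : Prop :=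
  ∃ (R : B →ₗ[ℂ] A) (Θ : A →ₗ[ℂ] B),
    IsTraceAdjoint ψ φ R Θ ∧ IsUnitalSchwarz Θ ∧ ∀ σ ∈ S, R (T σ) = σ

/-- `T` preserves the trace norms of `σ - t ρ` for `σ ∈ S` and `t ≥ 0`. -/
def PreservesTraceNorm (φ : A →ₗ[ℂ] ℂ) (ψ : B →ₗ[ℂ] ℂ) (T : A →ₗ[ℂ] B) (ρ : A)
    (S : Set A) : Prop :=
  ∀ σ ∈ S, ∀ t : ℝ, 0 ≤ t → traceNorm φ (σ - t • ρ) = traceNorm ψ (T σ - t • T ρ)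

/-- The smallest family containing `S` that is invariant under the modular group of `ρ`. -/
def extFamily (ρ : A) (S : Set A) : Set A := ⋃ s : ℝ, modularMap ρ (Complex.I * s) '' S

lemma PreservesTraceNorm.mono {S' : Set A} (h : PreservesTraceNorm φ ψ T ρ S') (hS : S ⊆ S') :
    PreservesTraceNorm φ ψ T ρ S := fun σ hσ => h σ (hS hσ)

lemma subset_extFamily (hρ : IsStrictlyPositive ρ) (S : Set A) : S ⊆ extFamily ρ S := fun σ hσ =>
  Set.mem_iUnion.2 ⟨0, σ, hσ, by simp [modularMap_zero hρ]⟩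

lemma extFamily_eq_of_forall_image_subset (hρ : IsStrictlyPositive ρ)
    (h : ∀ s : ℝ, modularMap ρ (Complex.I * s) '' S ⊆ S) : extFamily ρ S = S :=
  (Set.iUnion_subset h).antisymm (subset_extFamily hρ S)

lemma isSelfAdjoint_sub_smul (hρ : IsStrictlyPositive ρ) (hσ : 0 ≤ σ) (t : ℝ) :
    IsSelfAdjoint (σ - t • ρ) :=
  (IsSelfAdjoint.of_nonneg hσ).sub ((IsSelfAdjoint.all t).smul hρ.isSelfAdjoint)

variable [FiniteDimensional ℂ A]

lemma extFamily_eq_of_forall_commute (hρ : IsStrictlyPositive ρ) (h : ∀ σ ∈ S, Commute σ ρ) :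
    extFamily ρ S = S :=
  extFamily_eq_of_forall_image_subset hρ fun s => by
    rintro _ ⟨σ, hσ, rfl⟩
    rwa [modularMap_of_commute hρ (h σ hσ)]

lemma nonneg_of_mem_extFamily (hρ : IsStrictlyPositive ρ) (hS : ∀ σ ∈ S, 0 ≤ σ)
    (hσ : σ ∈ extFamily ρ S) : 0 ≤ σ := by
  obtain ⟨s, τ, hτ, rfl⟩ := Set.mem_iUnion.1 hσ
  exact modularMap_I_mul_nonneg hρ s (hS τ hτ)

/-- Conjugation by `ρ ^ (-1/2)` turns `σ - t ρ` into `M - t` for a selfadjoint `M`, so the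
projections onto the kernels of `σ - t ρ` inherit the completeness of the spectral projections
of `M`. -/
lemma eq_of_forall_mul_specProj_eq (hρ : IsStrictlyPositive ρ) (hσ : 0 ≤ σ) {x y : A}
    (h : ∀ t : ℝ, x * specProj (σ - t • ρ) 0 = y * specProj (σ - t • ρ) 0) : x = y := by
  set r := opPow ρ (-(1 / 2))
  set M := r * σ * r
  have hr : IsSelfAdjoint r := by simp [r, IsSelfAdjoint, star_opPow hρ]
  have hM : IsSelfAdjoint M := by
    simpa [hr.star_eq] using (IsSelfAdjoint.of_nonneg hσ).conjugate r
  have hσr : σ * r = opPow ρ (1 / 2) * M := by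
    simp only [M, ← mul_assoc, r, opPow_mul_opPow_neg hρ, one_mul]
  have hker (t : ℝ) : (x - y) * (r * specProj M t) = 0 := by
    have hzero : (σ - t • ρ) * (r * specProj M t) = 0 := by
      rw [sub_mul, ← mul_assoc, hσr, mul_assoc, mul_specProj hM, smul_mul_assoc, ← mul_assoc,
        mul_opPow_neg_half hρ, mul_smul_comm, sub_self]
    rw [← specProj_zero_mul_of_mul_eq_zero (isSelfAdjoint_sub_smul hρ hσ t) hzero, ← mul_assoc,
      sub_mul, h, sub_self, zero_mul]
  have hsum : (x - y) * r = 0 := by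
    rw [← mul_one r, ← sum_specProj hM, Finset.mul_sum, Finset.mul_sum]
    exact Finset.sum_eq_zero fun t _ => hker t
  refine sub_eq_zero.1 ?_
  rw [← mul_one (x - y), ← opPow_neg_mul_opPow hρ (1 / 2), ← mul_assoc, hsum, zero_mul]

variable [FiniteDimensional ℂ B]

lemma IsReversible.preservesTraceNorm (h : IsReversible φ ψ T S) (hT : IsTraceAdjoint φ ψ T Φ)
    (hΦ : IsUnitalSchwarz Φ) (hφ : IsFaithfulTrace φ) (hψ : IsFaithfulTrace ψ)
    (hρ : IsStrictlyPositive ρ) (hρS : ρ ∈ S) (hS : ∀ σ ∈ S, 0 ≤ σ) :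
    PreservesTraceNorm φ ψ T ρ (extFamily ρ S) := by
  obtain ⟨R, Θ, hR, hΘ, hRT⟩ := h
  intro τ hτ t _
  have hfix : R (T τ) = τ := by
    obtain ⟨s, σ, hσ, rfl⟩ := Set.mem_iUnion.1 hτ
    exact (hR.comp hT).map_modularMap_of_fixed (hΦ.comp hΘ) hφ hρ (hRT ρ hρS) (hRT σ hσ) _
  set X := τ - t • ρ
  have hX : IsSelfAdjoint X := isSelfAdjoint_sub_smul hρ (nonneg_of_mem_extFamily hρ hS hτ) t
  have hTX : T X = T τ - t • T ρ := by rw [map_sub, LinearMap.map_smul_of_tower]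
  have hRX : R (T X) = X := by
    rw [hTX, map_sub, LinearMap.map_smul_of_tower, hfix, hRT ρ hρS]
  rw [← hTX]
  refine le_antisymm ?_ (hT.traceNorm_map_le hΦ hφ hψ hX)
  calc traceNorm φ X = traceNorm φ (R (T X)) := by rw [hRX]
    _ ≤ traceNorm ψ (T X) :=
      hR.traceNorm_map_le hΘ hψ hφ (hT.isSelfAdjoint_map hΦ hφ hψ hX)

namespace PreservesTraceNorm

omit [FiniteDimensional ℂ A] [FiniteDimensional ℂ B] in
/-- For `t ≤ 0` both sides are traces of positive elements. -/
lemma traceNorm_sub_smul_eq (h : PreservesTraceNorm φ ψ T ρ S) (hT : IsTraceAdjoint φ ψ T Φ)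
    (hΦ : IsUnitalSchwarz Φ) (hφ : IsFaithfulTrace φ) (hψ : IsFaithfulTrace ψ) (hρ : 0 ≤ ρ)
    (hσS : σ ∈ S) (hσ : 0 ≤ σ) (t : ℝ) :
    traceNorm φ (σ - t • ρ) = traceNorm ψ (T σ - t • T ρ) := by
  rcases le_total 0 t with ht | ht
  · exact h σ hσS t ht
  · have hpos : 0 ≤ σ - t • ρ := sub_nonneg.2 ((smul_nonpos_of_nonpos_of_nonneg ht hρ).trans hσ)
    have hTpos := hT.map_nonneg hΦ hφ hψ hpos
    rw [← LinearMap.map_smul_of_tower, ← map_sub, traceNorm_of_nonneg φ hpos,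
      traceNorm_of_nonneg ψ hTpos, hT.map_trace hΦ]

lemma specProj_mem_map_multDomain (h : PreservesTraceNorm φ ψ T ρ S) (hT : IsTraceAdjoint φ ψ T Φ)
    (hΦ : IsUnitalSchwarz Φ) (hφ : IsFaithfulTrace φ) (hψ : IsFaithfulTrace ψ)
    (hρ : IsStrictlyPositive ρ) (hσS : σ ∈ S) (hσ : 0 ≤ σ) (t : ℝ) :
    specProj (σ - t • ρ) 0 ∈ (multDomain Φ).map Φ := by
  have hk : Φ (specProj (T (σ - t • ρ)) 0) = specProj (σ - t • ρ) 0 := by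
    refine hT.map_specProj_zero hΦ hφ hψ (isSelfAdjoint_sub_smul hρ hσ t) hρ fun e => ?_
    convert h.traceNorm_sub_smul_eq hT hΦ hφ hψ hρ.nonneg hσS hσ (t - e) using 2
    · module
    · rw [map_sub, LinearMap.map_smul_of_tower]
      module
  refine ⟨_, hΦ.mem_multDomain_of_isStarProjection (isStarProjection_specProj _ 0) ?_, hk⟩
  exact hk ▸ isStarProjection_specProj _ 0

lemma modularMap_specProj_mem_map_multDomain (h : PreservesTraceNorm φ ψ T ρ (extFamily ρ S))
    (hT : IsTraceAdjoint φ ψ T Φ) (hΦ : IsUnitalSchwarz Φ) (hφ : IsFaithfulTrace φ)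
    (hψ : IsFaithfulTrace ψ) (hρ : IsStrictlyPositive ρ) (hσS : σ ∈ S) (hσ : 0 ≤ σ) (t s : ℝ) :
    modularMap ρ (Complex.I * s) (specProj (σ - t • ρ) 0) ∈ (multDomain Φ).map Φ := by
  rw [modularMap_specProj hρ s (isSelfAdjoint_sub_smul hρ hσ t), map_sub,
    LinearMap.map_smul_of_tower, modularMap_of_commute hρ (Commute.refl ρ)]
  exact h.specProj_mem_map_multDomain hT hΦ hφ hψ hρ
    (Set.mem_iUnion.2 ⟨s, σ, hσS, rfl⟩) (modularMap_I_mul_nonneg hρ s hσ) t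

/-- The adjoint of `petzMap T Φ ρ ∘ T` fixes the projections `k` onto the kernels of `σ - t ρ`.
Hence `petzMap T Φ ρ (T σ) k = t ρ k = σ k`. -/
lemma petzMap_map_eq (h : PreservesTraceNorm φ ψ T ρ (extFamily ρ S))
    (hT : IsTraceAdjoint φ ψ T Φ) (hΦ : IsUnitalSchwarz Φ) (hφ : IsFaithfulTrace φ)
    (hψ : IsFaithfulTrace ψ) (hρ : IsStrictlyPositive ρ) (hTρ : IsStrictlyPositive (T ρ))
    (hdual : IsUnitalSchwarz (dualMap T ρ)) (hσS : σ ∈ S) (hσ : 0 ≤ σ) :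
    petzMap T Φ ρ (T σ) = σ := by
  set R := petzMap T Φ ρ
  have hRρ : R (T ρ) = ρ := petzMap_map_self hΦ.map_one hρ hTρ
  have hL : IsTraceAdjoint φ φ (R ∘ₗ T) (Φ ∘ₗ dualMap T ρ) :=
    (isTraceAdjoint_petzMap hT hφ hψ).comp hT
  refine eq_of_forall_mul_specProj_eq hρ hσ fun t => ?_
  set k := specProj (σ - t • ρ) 0
  have hk : Φ (dualMap T ρ k) = k := hT.map_dualMap_of_modularMap_mem hφ hψ hρ hTρ
    (h.modularMap_specProj_mem_map_multDomain hT hΦ hφ hψ hρ hσS hσ t)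
  have hker : (σ - t • ρ) * k = 0 := mul_specProj_zero (isSelfAdjoint_sub_smul hρ hσ t)
  have hLker : (R (T σ) - t • ρ) * k = 0 := by
    have hfix := hL.map_mul_of_fixed_right (hΦ.comp hdual) hφ hρ hRρ hk (σ - t • ρ)
    rw [hker, map_zero] at hfix
    simpa only [map_sub, LinearMap.map_smul_of_tower, LinearMap.comp_apply, hRρ] using hfix.symm
  rw [sub_mul, sub_eq_zero] at hker hLker
  rw [hker, hLker]

lemma isReversible (h : PreservesTraceNorm φ ψ T ρ (extFamily ρ S))
    (hT : IsTraceAdjoint φ ψ T Φ) (hΦ : IsUnitalSchwarz Φ) (hφ : IsFaithfulTrace φ)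
    (hψ : IsFaithfulTrace ψ) (hρ : IsStrictlyPositive ρ) (hTρ : IsStrictlyPositive (T ρ))
    (hdual : IsUnitalSchwarz (dualMap T ρ)) (hS : ∀ σ ∈ S, 0 ≤ σ) : IsReversible φ ψ T S :=
  ⟨petzMap T Φ ρ, dualMap T ρ, isTraceAdjoint_petzMap hT hφ hψ, hdual, fun σ hσ =>
    h.petzMap_map_eq hT hΦ hφ hψ hρ hTρ hdual hσ (hS σ hσ)⟩

end PreservesTraceNorm

end Reversibility

section Commutative

variable {A B : Type*} [CStarAlgebra A] [PartialOrder A] [StarOrderedRing A]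
  [FiniteDimensional ℂ A] [CStarAlgebra B] [PartialOrder B] [StarOrderedRing B]
  [FiniteDimensional ℂ B]
  {φ : A →ₗ[ℂ] ℂ} {ψ : B →ₗ[ℂ] ℂ} {T : A →ₗ[ℂ] B} {Φ : B →ₗ[ℂ] A} {ρ σ τ : A} {S : Set A}

omit [PartialOrder A] [StarOrderedRing A] [FiniteDimensional ℂ A] [PartialOrder B]
  [StarOrderedRing B] [FiniteDimensional ℂ B] in
lemma commute_of_mem_map_multDomain (hB : ∀ x y : B, x * y = y * x) {a b : A}
    (ha : a ∈ (multDomain Φ).map Φ) (hb : b ∈ (multDomain Φ).map Φ) : Commute a b := by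
  obtain ⟨m, hm, rfl⟩ := ha
  obtain ⟨n, -, rfl⟩ := hb
  rw [Commute, SemiconjBy, ← (hm n).1, ← (hm n).2, hB]

lemma opPow_neg_one_mul_mul_specProj (hρ : IsStrictlyPositive ρ) (hσ : 0 ≤ σ) (t : ℝ) :
    opPow ρ (-1) * σ * specProj (σ - t • ρ) 0 = t • specProj (σ - t • ρ) 0 := by
  have hker := mul_specProj_zero (isSelfAdjoint_sub_smul hρ hσ t)
  rw [sub_mul, sub_eq_zero] at hker
  rw [mul_assoc, hker, smul_mul_assoc, mul_smul_comm, ← mul_assoc,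
    opPow_neg_one_mul_self hρ, one_mul]

lemma commute_opPow_neg_one_mul (hρ : IsStrictlyPositive ρ) (hσ : 0 ≤ σ) {b : A}
    (h : ∀ t : ℝ, Commute b (specProj (σ - t • ρ) 0)) : Commute (opPow ρ (-1) * σ) b := by
  refine eq_of_forall_mul_specProj_eq hρ hσ fun t => ?_
  rw [mul_assoc, (h t).eq, ← mul_assoc, opPow_neg_one_mul_mul_specProj hρ hσ, mul_assoc,
    opPow_neg_one_mul_mul_specProj hρ hσ, smul_mul_assoc, mul_smul_comm, (h t).eq]

/-- The element `ρ⁻¹ σ` acts by the real scalar `t` on the kernel of `σ - t ρ`. As it commutes with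
the projections onto these kernels, so does its adjoint, which therefore acts in the same way. -/
lemma isSelfAdjoint_opPow_neg_one_mul (hρ : IsStrictlyPositive ρ) (hσ : 0 ≤ σ)
    (h : ∀ s t : ℝ, Commute (specProj (σ - s • ρ) 0) (specProj (σ - t • ρ) 0)) :
    IsSelfAdjoint (opPow ρ (-1) * σ) := by
  refine eq_of_forall_mul_specProj_eq hρ hσ fun t => ?_
  have hk := (isStarProjection_specProj (σ - t • ρ) 0).isSelfAdjoint.star_eq
  have hcomm := commute_opPow_neg_one_mul hρ hσ (h t)
  have hstar := congrArg star (hcomm.eq.symm.trans (opPow_neg_one_mul_mul_specProj hρ hσ t))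
  rw [star_mul, star_smul, hk, (IsSelfAdjoint.all t).star_eq] at hstar
  rw [hstar, opPow_neg_one_mul_mul_specProj hρ hσ]

lemma commute_of_forall_commute_specProj_self (hρ : IsStrictlyPositive ρ) (hσ : 0 ≤ σ)
    (h : ∀ s t : ℝ, Commute (specProj (σ - s • ρ) 0) (specProj (σ - t • ρ) 0)) :
    Commute σ ρ := by
  have hsa := isSelfAdjoint_opPow_neg_one_mul hρ hσ h
  have hσx : σ = ρ * (opPow ρ (-1) * σ) := by rw [← mul_assoc, mul_opPow_neg_one hρ, one_mul]
  have hxσ := congrArg star hσx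
  rw [(IsSelfAdjoint.of_nonneg hσ).star_eq, star_mul, hsa.star_eq, hρ.isSelfAdjoint.star_eq] at hxσ
  have hx : Commute ρ (opPow ρ (-1) * σ) := hσx.symm.trans hxσ
  rw [hσx]
  exact ((Commute.refl ρ).mul_right hx).symm

lemma commute_of_forall_commute_specProj (hρ : IsStrictlyPositive ρ) (hσ : 0 ≤ σ) (hτ : 0 ≤ τ)
    (hσρ : Commute σ ρ) (hτρ : Commute τ ρ)
    (h : ∀ s t : ℝ, Commute (specProj (σ - s • ρ) 0) (specProj (τ - t • ρ) 0)) :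
    Commute σ τ := by
  have hinv : Commute (opPow ρ (-1)) ρ :=
    (opPow_neg_one_mul_self hρ).trans (mul_opPow_neg_one hρ).symm
  have hx : Commute (opPow ρ (-1) * σ) (opPow ρ (-1) * τ) :=
    commute_opPow_neg_one_mul hρ hσ fun s => commute_opPow_neg_one_mul hρ hτ fun t => h s t
  have hρx : Commute ρ (opPow ρ (-1) * σ) := (hinv.mul_left hσρ).symm
  have hρy : Commute ρ (opPow ρ (-1) * τ) := (hinv.mul_left hτρ).symm
  have hprod : Commute (ρ * (opPow ρ (-1) * σ)) (ρ * (opPow ρ (-1) * τ)) :=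
    ((Commute.refl ρ).mul_right hρy).mul_left (hρx.symm.mul_right hx)
  rwa [← mul_assoc, ← mul_assoc, mul_opPow_neg_one hρ, one_mul, one_mul] at hprod

lemma PreservesTraceNorm.commute (h : PreservesTraceNorm φ ψ T ρ S)
    (hT : IsTraceAdjoint φ ψ T Φ) (hΦ : IsUnitalSchwarz Φ) (hφ : IsFaithfulTrace φ)
    (hψ : IsFaithfulTrace ψ) (hρ : IsStrictlyPositive ρ) (hS : ∀ σ ∈ S, 0 ≤ σ)
    (hB : ∀ x y : B, x * y = y * x) (hσ : σ ∈ S) (hτ : τ ∈ S) : Commute σ τ := by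
  have hmem {σ : A} (hσ : σ ∈ S) (t : ℝ) : specProj (σ - t • ρ) 0 ∈ (multDomain Φ).map Φ :=
    h.specProj_mem_map_multDomain hT hΦ hφ hψ hρ hσ (hS σ hσ) t
  have hcomm {σ τ : A} (hσ : σ ∈ S) (hτ : τ ∈ S) (s t : ℝ) :
      Commute (specProj (σ - s • ρ) 0) (specProj (τ - t • ρ) 0) :=
    commute_of_mem_map_multDomain hB (hmem hσ s) (hmem hτ t)
  exact commute_of_forall_commute_specProj hρ (hS σ hσ) (hS τ hτ)
    (commute_of_forall_commute_specProj_self hρ (hS σ hσ) (hcomm hσ hσ))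
    (commute_of_forall_commute_specProj_self hρ (hS τ hτ) (hcomm hτ hτ)) (hcomm hσ hτ)

end Commutative

section Subalgebra

variable {M : Type*} [CStarAlgebra M] [PartialOrder M] [StarOrderedRing M]
  {N : StarSubalgebra ℂ M} [IsClosed (N : Set M)]

lemma exists_eq_star_mul_self_of_coe_nonneg {a : N} (ha : 0 ≤ (a : M)) :
    ∃ c : N, a = star c * c := by
  have hsa : IsSelfAdjoint a := Subtype.ext (IsSelfAdjoint.of_nonneg ha).star_eq
  have hspec : ∀ x ∈ spectrum ℝ a, 0 ≤ x := by
    intro x hx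
    rw [← spectrum.preimage_algebraMap ℂ, Set.mem_preimage, StarSubalgebra.spectrum_eq,
      ← Set.mem_preimage, spectrum.preimage_algebraMap] at hx
    exact spectrum_nonneg_of_nonneg ha hx
  refine ⟨cfc Real.sqrt a, ?_⟩
  rw [(cfc_predicate Real.sqrt a : IsSelfAdjoint _).star_eq, ← cfc_mul Real.sqrt Real.sqrt a]
  conv_lhs => rw [← cfc_id' ℝ a]
  exact cfc_congr fun x hx => (Real.mul_self_sqrt (hspec x hx)).symm

instance starOrderedRing_starSubalgebra : StarOrderedRing N :=
  StarOrderedRing.of_nonneg_iff' (fun h z => add_le_add_right (α := M) h z) fun x =>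
    ⟨exists_eq_star_mul_self_of_coe_nonneg, by
      rintro ⟨s, rfl⟩
      exact star_mul_self_nonneg (s : M)⟩

lemma coe_cfcAbs (a : N) : ((CFC.abs a : N) : M) = CFC.abs (a : M) :=
  (CFC.sqrt_unique (congrArg Subtype.val (CFC.abs_mul_abs a)) (CFC.abs_nonneg a)).symm

end Subalgebra

end Tracial

open Tracial in
theorem theorem5_general {A B : Type*}
    [CStarAlgebra A] [PartialOrder A] [StarOrderedRing A] [FiniteDimensional ℂ A]
    [CStarAlgebra B] [PartialOrder B] [StarOrderedRing B] [FiniteDimensional ℂ B]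
    {φ : A →ₗ[ℂ] ℂ} {ψ : B →ₗ[ℂ] ℂ} (hφ : IsFaithfulTrace φ) (hψ : IsFaithfulTrace ψ)
    {T : A →ₗ[ℂ] B} {Φ : B →ₗ[ℂ] A} (hTΦ : IsTraceAdjoint φ ψ T Φ)
    {S : Set A} (hS : ∀ σ ∈ S, 0 ≤ σ) {ρ : A} (hρS : ρ ∈ S) (hρ : IsUnit ρ) (hTρ : IsUnit (T ρ))
    (hΦ : IsUnitalSchwarz Φ) (hdual : IsUnitalSchwarz (dualMap T ρ)) :
    (IsReversible φ ψ T S ↔ PreservesTraceNorm φ ψ T ρ (extFamily ρ S)) ∧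
    ((∀ s : ℝ, modularMap ρ (Complex.I * s) '' S ⊆ S) →
      (IsReversible φ ψ T S ↔ PreservesTraceNorm φ ψ T ρ S)) ∧
    ((∀ x y : B, x * y = y * x) →
      (IsReversible φ ψ T S ↔ PreservesTraceNorm φ ψ T ρ S) ∧
      (IsReversible φ ψ T S → ∀ σ ∈ S, ∀ τ ∈ S, σ * τ = τ * σ)) ∧
    ((∀ σ ∈ S, σ * ρ = ρ * σ) →
      (IsReversible φ ψ T S ↔ PreservesTraceNorm φ ψ T ρ S)) := by
  have hρ' : IsStrictlyPositive ρ := hρ.isStrictlyPositive (hS ρ hρS)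
  have hTρ' : IsStrictlyPositive (T ρ) :=
    hTρ.isStrictlyPositive (hTΦ.map_nonneg hΦ hφ hψ hρ'.nonneg)
  have hext : IsReversible φ ψ T S ↔ PreservesTraceNorm φ ψ T ρ (extFamily ρ S) :=
    ⟨fun h => h.preservesTraceNorm hTΦ hΦ hφ hψ hρ' hρS hS,
      fun h => h.isReversible hTΦ hΦ hφ hψ hρ' hTρ' hdual hS⟩
  have hcommute (h : ∀ σ ∈ S, Commute σ ρ) :
      IsReversible φ ψ T S ↔ PreservesTraceNorm φ ψ T ρ S := by
    rw [hext, extFamily_eq_of_forall_commute hρ' h]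
  refine ⟨hext, fun h => ?_, fun hB => ?_, hcommute⟩
  · rw [hext, extFamily_eq_of_forall_image_subset hρ' h]
  · have hpres (h : IsReversible φ ψ T S) : PreservesTraceNorm φ ψ T ρ S :=
      (hext.1 h).mono (subset_extFamily hρ' S)
    refine ⟨⟨hpres, fun h => (hcommute fun σ hσ => ?_).2 h⟩, fun h σ hσ τ hτ => ?_⟩
    · exact h.commute hTΦ hΦ hφ hψ hρ' hS hB hσ hρS
    · exact (hpres h).commute hTΦ hΦ hφ hψ hρ' hS hB hσ hτ

namespace QRev

open scoped ComplexOrder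

section Bridge

variable {H K : Type*}
  [NormedAddCommGroup H] [InnerProductSpace ℂ H] [CompleteSpace H] [FiniteDimensional ℂ H]
  [NormedAddCommGroup K] [InnerProductSpace ℂ K] [CompleteSpace K] [FiniteDimensional ℂ K]
  {A : StarSubalgebra ℂ (H →L[ℂ] H)} {B : StarSubalgebra ℂ (K →L[ℂ] K)}
  {T : A →ₗ[ℂ] B} {Φ : B →ₗ[ℂ] A} {ρ : A} {S : Set A}

/-- The trace of `B(H)`, restricted to a subalgebra. -/
noncomputable def subTr (A : StarSubalgebra ℂ (H →L[ℂ] H)) : A →ₗ[ℂ] ℂ :=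
  tr ∘ₗ A.subtype.toLinearMap

lemma tr_star_mul_self_nonneg (x : H →L[ℂ] H) : 0 ≤ tr (star x * x) := by
  change 0 ≤ LinearMap.trace ℂ H _
  rw [LinearMap.trace_eq_sum_inner _ (stdOrthonormalBasis ℂ H)]
  refine Finset.sum_nonneg fun i _ => ?_
  change 0 ≤ inner ℂ _ ((ContinuousLinearMap.adjoint x) (x _))
  rw [ContinuousLinearMap.adjoint_inner_right, inner_self_eq_norm_sq_to_K]
  exact pow_nonneg (RCLike.ofReal_nonneg.2 (norm_nonneg _)) 2

lemma isFaithfulTrace_subTr (A : StarSubalgebra ℂ (H →L[ℂ] H)) :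
    Tracial.IsFaithfulTrace (subTr A) where
  map_mul_comm a b := LinearMap.trace_mul_comm ℂ ((a : H →L[ℂ] H) : H →ₗ[ℂ] H) (b : H →L[ℂ] H)
  map_star_mul_self_nonneg a := tr_star_mul_self_nonneg (a : H →L[ℂ] H)
  eq_zero_of_map_star_mul_self a h := Subtype.ext (eq_zero_of_tr_star_mul_self (a : H →L[ℂ] H) h)

lemma isUnitalSchwarz_iff : IsUnitalSchwarz T ↔ Tracial.IsUnitalSchwarz T :=
  ⟨fun h => ⟨h.1, h.2⟩, fun h => ⟨h.1, h.2⟩⟩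

lemma hsAdjoint_eq (hT : Tracial.IsTraceAdjoint (subTr A) (subTr B) T Φ)
    (hΦ : ∀ b, Φ (star b) = star (Φ b)) : hsAdjoint T = Φ := by
  have hA := isFaithfulTrace_subTr A
  ext1 b
  refine star_injective (hA.ext fun a => ?_)
  calc subTr A (star (hsAdjoint T b) * a) = subTr B (star b * T a) := hsAdjoint_spec T a b
    _ = subTr A (star (Φ b) * a) := by
      rw [(isFaithfulTrace_subTr B).map_mul_comm, hT, hΦ, hA.map_mul_comm]

lemma isTraceAdjoint_hsAdjoint (hT : ∀ b, hsAdjoint T (star b) = star (hsAdjoint T b)) :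
    Tracial.IsTraceAdjoint (subTr A) (subTr B) T (hsAdjoint T) := fun a b => by
  calc subTr B (T a * b) = subTr B (star (star b) * T a) := by
        rw [star_star, (isFaithfulTrace_subTr B).map_mul_comm]
    _ = subTr A (star (hsAdjoint T (star b)) * a) := (hsAdjoint_spec T a (star b)).symm
    _ = subTr A (a * hsAdjoint T b) := by
        rw [hT, star_star, (isFaithfulTrace_subTr A).map_mul_comm]

lemma isReversible_iff :
    IsReversible T S ↔ Tracial.IsReversible (subTr A) (subTr B) T S := by
  constructor
  · rintro ⟨R, hR, hRT⟩
    have hR' := isUnitalSchwarz_iff.1 hR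
    exact ⟨R, hsAdjoint R, isTraceAdjoint_hsAdjoint hR'.map_star, hR', hRT⟩
  · rintro ⟨R, Θ, hRΘ, hΘ, hRT⟩
    exact ⟨R, hsAdjoint_eq hRΘ hΘ.map_star ▸ isUnitalSchwarz_iff.2 hΘ, hRT⟩

lemma traceNorm_coe (a : A) : traceNorm (a : H →L[ℂ] H) = Tracial.traceNorm (subTr A) a :=
  congrArg (fun x => (tr x).re) (Tracial.coe_cfcAbs a).symm

lemma preservesTraceNorm_iff :
    PreservesTraceNorm T ρ S ↔ Tracial.PreservesTraceNorm (subTr A) (subTr B) T ρ S := by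
  simp only [PreservesTraceNorm, Tracial.PreservesTraceNorm, traceNorm_coe, Complex.coe_smul]

end Bridge

end QRev

theorem theorem5 {H K : Type*}
    [NormedAddCommGroup H] [InnerProductSpace ℂ H] [CompleteSpace H] [FiniteDimensional ℂ H]
    [NormedAddCommGroup K] [InnerProductSpace ℂ K] [CompleteSpace K] [FiniteDimensional ℂ K]
    (A : StarSubalgebra ℂ (H →L[ℂ] H)) (B : StarSubalgebra ℂ (K →L[ℂ] K))
    (T : A →ₗ[ℂ] B) (S : Set A) (hS : ∀ σ ∈ S, QRev.IsState σ)
    (ρ : A) (hρS : ρ ∈ S) (hρ : IsUnit ρ) (hTρ : IsUnit (T ρ))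
    (hT : QRev.IsUnitalSchwarz (QRev.hsAdjoint T))
    (hTdual : QRev.IsUnitalSchwarz (QRev.dualMap T ρ)) :
    (QRev.IsReversible T S ↔ QRev.PreservesTraceNorm T ρ (QRev.extFamily ρ S)) ∧
    ((∀ s : ℝ, QRev.modConj ρ s '' S ⊆ S) →
      (QRev.IsReversible T S ↔ QRev.PreservesTraceNorm T ρ S)) ∧
    ((∀ x y : B, x * y = y * x) →
      (QRev.IsReversible T S ↔ QRev.PreservesTraceNorm T ρ S) ∧
      (QRev.IsReversible T S → ∀ σ ∈ S, ∀ τ ∈ S, σ * τ = τ * σ)) ∧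
    ((∀ σ ∈ S, σ * ρ = ρ * σ) →
      (QRev.IsReversible T S ↔ QRev.PreservesTraceNorm T ρ S)) := by
  simp only [QRev.isReversible_iff, QRev.preservesTraceNorm_iff]
  exact theorem5_general (QRev.isFaithfulTrace_subTr A) (QRev.isFaithfulTrace_subTr B)
    (QRev.isTraceAdjoint_hsAdjoint (QRev.isUnitalSchwarz_iff.1 hT).map_star)
    (fun σ hσ => (hS σ hσ).1) hρS hρ hTρ (QRev.isUnitalSchwarz_iff.1 hT)
    (QRev.isUnitalSchwarz_iff.1 hTdual)
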